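/- Let $T>0$, and let $\sigma$ be the surface area measure on the unit sphere $\mathbb S^2\subset\mathbb R^3$ (total mass $4\pi$). For every $j\ge 0$ let $(\mathcal Y_{j,m})_{m=-j}^{j}$ be real spherical harmonics of degree $j$ (restrictions to $\mathbb S^2$ of homogeneous harmonic polynomials of degree $j$) that are orthonormal in $L^2(\mathbb S^2,\sigma)$, and put $c_j=\sqrt{4\pi/(2j+1)}$. Let $\{X_{j,m}(t),\,t\in\mathbb R\}$, $j\ge 0$, $|m|\le j$, be measurable, jointly Gaussian, zero-mean stationary processes on a probability space with $$\mathbb E\{X_{j,m}(t)X_{j',m'}(s)\}=\varphi_j(t-s)\,\delta_{jj'}\delta_{mm'},\qquad t,s\in\mathbb R,$$ where each $\varphi_j:\mathbb R\to\mathbb R$ is continuous, and let $Z$ be a measurable random field on $\mathbb S^2\times\mathbb R$ such that $$Z(\mathbf x,t)=\sum_{j=0}^\infty c_j\sum_{m=-j}^{j}X_{j,m}(t)\,\mathcal Y_{j,m}(\mathbf x),$$ the series converging in mean square for every $(\mathbf x,t)$. For every $j$ let $(\zeta_{k,j})_{k\ge 0}$ be an orthonormal basis of $L^2([0,T])$ consisting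 of eigenfunctions, with eigenvalues $(a_{k,j})_{k\ge0}$, of the integral operator $f\mapsto\int_0^T\varphi_j(\cdot-s)f(s)\,\mathrm ds$ on $L^2([0,T])$ (in particular, all the bases may coincide, $\zeta_{k,j}=\zeta_k$). Put $\lambda_{k,j,m}=\int_0^T X_{j,m}(t)\zeta_{k,j}(t)\,\mathrm dt$ and, for integers $J,K\ge 0$, $$\widehat Z(\mathbf x,t)=\sum_{j=0}^{J}c_j\sum_{m=-j}^{j}\sum_{k=0}^{K}\lambda_{k,j,m}\,\zeta_{k,j}(t)\,\mathcal Y_{j,m}(\mathbf x).$$ Suppose that $\sum_{j=0}^\infty\sum_{k=0}^\infty a_{k,j}<\infty$. Then for every $\epsilon>0$ $$\mathbb P\Big\{\|Z-\widehat Z\|_{L^2(\mathbb S^2\times[0,T])}>\sqrt{P_{J,K}+\epsilon\,Q_{J,K}}\Big\}\le e^{-\epsilon/2}\sqrt{\epsilon+1},$$ where $$P_{J,K}=4\pi\Big(\sum_{j=J+1}^{\infty}\sum_{k=0}^\infty a_{k,j}+\sum_{j=0}^{J}\sum_{k=K+1}^\infty a_{k,j}\Big),$$ $$Q_{J,K}=4\pi\Big(\sum_{j=J+1}^{\infty}c_j^2\sum_{k=0}^\infty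 a_{k,j}^2+\sum_{j=0}^{J}c_j^2\sum_{k=K+1}^\infty a_{k,j}^2\Big)^{1/2}.$$ -/

import Mathlib

open MeasureTheory ProbabilityTheory Filter Topology Set

noncomputable section

namespace SphereTime

/-- The unit sphere `S²` of `ℝ³`. -/
abbrev S2 : Type := Metric.sphere (0 : EuclideanSpace ℝ (Fin 3)) 1

/-- The surface area measure on `S²` (of total mass `4π`). -/
def surface : Measure S2 := (volume : Measure (EuclideanSpace ℝ (Fin 3))).toSphere

/-- Lebesgue measure on the time interval `[0, T]`. -/
def timeMeasure (T : ℝ) : Measure ℝ := volume.restrict (Icc 0 T)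

/-- The real Hilbert space `L²([0, T])`. -/
abbrev TimeL2 (T : ℝ) : Type := Lp ℝ 2 (timeMeasure T)

/-- Pairs `(j, m)`: a degree `j` and one of the `2 j + 1` labels of the spherical harmonics of
degree `j`. -/
abbrev Index : Type := Σ j : ℕ, Fin (2 * j + 1)

/-- A (real) spherical harmonic of degree `j` on `S²`: the restriction to the sphere of a
homogeneous harmonic polynomial of degree `j` in three variables. -/
def IsSphericalHarmonic (j : ℕ) (f : S2 → ℝ) : Prop :=
  ∃ p : MvPolynomial (Fin 3) ℝ, p.IsHomogeneous j ∧
    ∑ i, MvPolynomial.pderiv i (MvPolynomial.pderiv i p) = 0 ∧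
    ∀ x : S2, f x = MvPolynomial.eval (fun i => x.1 i) p

/-- For every degree `j`, the functions `Y (j, m)`, `m = 1, …, 2 j + 1`, are spherical harmonics of
degree `j` that are orthonormal in `L²(S²)`, that is, an orthonormal basis of the
`(2 j + 1)`-dimensional space of spherical harmonics of degree `j`. -/
structure IsHarmonicBasis (Y : Index → S2 → ℝ) : Prop where
  harmonic : ∀ i : Index, IsSphericalHarmonic i.1 (Y i)
  orthonormal : ∀ (j : ℕ) (m m' : Fin (2 * j + 1)),
    ∫ x, Y ⟨j, m⟩ x * Y ⟨j, m'⟩ x ∂surface = if m = m' then 1 else 0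

/-- The normalising constant `c_j = √(4π / (2j + 1))`. -/
def c (j : ℕ) : ℝ := Real.sqrt (4 * Real.pi / (2 * j + 1))

variable {Ω : Type*} [MeasurableSpace Ω]

/-- The `X (j, m)` are (jointly measurable, jointly Gaussian) zero-mean stationary processes on `ℝ`,
those with different labels being uncorrelated, hence independent, and `X (j, m)` having the
continuous covariance function `φ j`. -/
structure IsCoefficientProcess (P : Measure Ω) (φ : ℕ → ℝ → ℝ) (X : Index → ℝ → Ω → ℝ) :
    Prop where
  continuous_cov : ∀ j, Continuous (φ j)
  measurable : ∀ i, Measurable fun p : ℝ × Ω => X i p.1 p.2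
  gaussian : IsGaussianProcess (fun q : Index × ℝ => X q.1 q.2) P
  centered : ∀ i t, ∫ ω, X i t ω ∂P = 0
  covariance : ∀ (i i' : Index) (t s : ℝ),
    ∫ ω, X i t ω * X i' s ω ∂P = if i = i' then φ i.1 (t - s) else 0

/-- `Z` is a random field on `S² × ℝ` with
`Z(x, t) = ∑_{j ≥ 0} c_j ∑_m X_{j,m}(t) Y_{j,m}(x)`,
the series converging in mean square at every `(x, t)`. -/
structure IsExpandedField (P : Measure Ω) (Y : Index → S2 → ℝ) (X : Index → ℝ → Ω → ℝ)
    (Z : S2 → ℝ → Ω → ℝ) : Prop where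
  measurable : Measurable fun p : (S2 × ℝ) × Ω => Z p.1.1 p.1.2 p.2
  expansion : ∀ (x : S2) (t : ℝ),
    Tendsto (fun N : ℕ => eLpNorm (fun ω => Z x t ω -
      ∑ j ∈ Finset.range N, c j * ∑ m : Fin (2 * j + 1), X ⟨j, m⟩ t ω * Y ⟨j, m⟩ x) 2 P)
      atTop (𝓝 0)

/-- For every `j`, the orthonormal basis `(ζ j k)_k` of `L²([0, T])` consists of eigenfunctions, with
eigenvalues `(a k j)_k`, of the integral operator on `L²([0, T])` with kernel `φ j (t - s)`. -/
def IsEigenSystem (T : ℝ) (φ : ℕ → ℝ → ℝ) (a : ℕ → ℕ → ℝ)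
    (ζ : ℕ → HilbertBasis ℕ ℝ (TimeL2 T)) : Prop :=
  ∀ j k : ℕ, ∀ᵐ t ∂(timeMeasure T),
    ∫ s, φ j (t - s) * (ζ j k : TimeL2 T) s ∂(timeMeasure T) = a k j * (ζ j k : TimeL2 T) t

/-- The Karhunen–Loève coefficients `λ_{k,j,m} = ∫_0^T X_{j,m}(t) ζ_k(t) dt`. -/
def klCoeff (T : ℝ) (X : Index → ℝ → Ω → ℝ) (ζ : ℕ → HilbertBasis ℕ ℝ (TimeL2 T))
    (k : ℕ) (i : Index) (ω : Ω) : ℝ :=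
  ∫ t, X i t ω * (ζ i.1 k : TimeL2 T) t ∂(timeMeasure T)

/-- The doubly truncated Karhunen–Loève expansion
`Ẑ(x, t) = ∑_{j=0}^J c_j ∑_m ∑_{k=0}^K λ_{k,j,m} ζ_k(t) Y_{j,m}(x)`. -/
def truncated (T : ℝ) (Y : Index → S2 → ℝ) (X : Index → ℝ → Ω → ℝ)
    (ζ : ℕ → HilbertBasis ℕ ℝ (TimeL2 T)) (J K : ℕ) (x : S2) (t : ℝ) (ω : Ω) : ℝ :=
  ∑ j ∈ Finset.range (J + 1), c j * ∑ m : Fin (2 * j + 1), ∑ k ∈ Finset.range (K + 1),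
    klCoeff T X ζ k ⟨j, m⟩ ω * (ζ j k : TimeL2 T) t * Y ⟨j, m⟩ x

/-- `‖f‖_{L²(S² × [0, T])}`, with value `∞` if `f` is not square integrable. -/
def l2norm (T : ℝ) (f : S2 → ℝ → ℝ) : ENNReal :=
  eLpNorm (fun p : S2 × ℝ => f p.1 p.2) 2 (surface.prod (timeMeasure T))

/-- `P_{J,K} = 4π (∑_{j > J} ∑_{k ≥ 0} a_{k,j} + ∑_{j ≤ J} ∑_{k > K} a_{k,j})`. -/
def tailP (a : ℕ → ℕ → ℝ) (J K : ℕ) : ℝ :=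
  4 * Real.pi * ((∑' j : ℕ, ∑' k : ℕ, a k (J + 1 + j)) +
    ∑ j ∈ Finset.range (J + 1), ∑' k : ℕ, a (K + 1 + k) j)

/-- `Q_{J,K} = 4π (∑_{j > J} c_j² ∑_{k ≥ 0} a_{k,j}² + ∑_{j ≤ J} c_j² ∑_{k > K} a_{k,j}²)^{1/2}`. -/
def tailQ (a : ℕ → ℕ → ℝ) (J K : ℕ) : ℝ :=
  4 * Real.pi * Real.sqrt ((∑' j : ℕ, c (J + 1 + j) ^ 2 * ∑' k : ℕ, a k (J + 1 + j) ^ 2) +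
    ∑ j ∈ Finset.range (J + 1), c j ^ 2 * ∑' k : ℕ, a (K + 1 + k) j ^ 2)

end SphereTime

end

namespace SphereTime

/-! ### A tail bound for weighted sums of squares of independent centred Gaussian variables -/

theorem neg_log_one_sub_sub_mul_sq_le {x u : ℝ} (hx : 0 ≤ x) (hxu : x ≤ u) (hu : u < 1) :
    (-Real.log (1 - x) - x) * u ^ 2 ≤ x ^ 2 * (-Real.log (1 - u) - u) := by
  have series : ∀ y : ℝ, 0 ≤ y → y < 1 →
      HasSum (fun n : ℕ => y ^ (n + 2) / ((n + 1 : ℕ) + 1 : ℝ)) (-Real.log (1 - y) - y) := by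
    intro y h0 h1
    have h := Real.hasSum_pow_div_log_of_abs_lt_one (x := y) (by rwa [abs_of_nonneg h0])
    rw [← hasSum_nat_add_iff' 1] at h
    simpa [add_assoc] using h
  refine hasSum_le (fun n => ?_) ((series x hx (hxu.trans_lt hu)).mul_right (u ^ 2))
    ((series u (hx.trans hxu) hu).mul_left (x ^ 2))
  have h : x ^ n ≤ u ^ n := pow_le_pow_left₀ hx hxu n
  have e1 : x ^ (n + 2) / ((n + 1 : ℕ) + 1 : ℝ) * u ^ 2 =
      x ^ n * (x ^ 2 * u ^ 2 / ((n + 1 : ℕ) + 1 : ℝ)) := by ring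
  have e2 : x ^ 2 * (u ^ (n + 2) / ((n + 1 : ℕ) + 1 : ℝ)) =
      u ^ n * (x ^ 2 * u ^ 2 / ((n + 1 : ℕ) + 1 : ℝ)) := by ring
  rw [e1, e2]
  gcongr

theorem integrable_exp_mul_sq_gaussianReal {v : NNReal} {s : ℝ} (h : 2 * s * v < 1) :
    Integrable (fun x => Real.exp (s * x ^ 2)) (gaussianReal 0 v) := by
  rcases eq_or_ne v 0 with rfl | hv
  · rw [gaussianReal_zero_var]
    exact integrable_dirac (by simp)
  have hv' : (0 : ℝ) < v := by positivity
  rw [gaussianReal_of_var_ne_zero 0 hv, integrable_withDensity_iff_integrable_smul'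
    (measurable_gaussianPDF 0 v) (ae_of_all _ fun _ => gaussianPDF_lt_top)]
  have hb : 0 < (1 - 2 * s * v) / (2 * v) := by
    have : 0 < 1 - 2 * s * v := by linarith
    positivity
  refine ((integrable_exp_neg_mul_sq hb).const_mul (Real.sqrt (2 * Real.pi * v))⁻¹).congr
    (ae_of_all _ fun x => ?_)
  simp only [toReal_gaussianPDF, gaussianPDFReal, smul_eq_mul, mul_assoc, ← Real.exp_add]
  congr 2
  field_simp
  ring

theorem integral_exp_mul_sq_gaussianReal {v : NNReal} {s : ℝ} (h : 2 * s * v < 1) :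
    ∫ x, Real.exp (s * x ^ 2) ∂(gaussianReal 0 v) = Real.exp (-Real.log (1 - 2 * s * v) / 2) := by
  rcases eq_or_ne v 0 with rfl | hv
  · simp [gaussianReal_zero_var]
  have hv' : (0 : ℝ) < v := by positivity
  have h1 : 0 < 1 - 2 * s * v := by linarith
  have hint : ∀ x, gaussianPDFReal 0 v x • Real.exp (s * x ^ 2) =
      (Real.sqrt (2 * Real.pi * v))⁻¹ * Real.exp (-((1 - 2 * s * v) / (2 * v)) * x ^ 2) := by
    intro x
    simp only [gaussianPDFReal, smul_eq_mul, mul_assoc, ← Real.exp_add]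
    congr 2
    field_simp
    ring
  rw [integral_gaussianReal_eq_integral_smul hv]
  simp only [hint]
  rw [integral_const_mul, integral_gaussian, ← Real.sqrt_inv, ← Real.sqrt_mul (by positivity)]
  have e : (2 * Real.pi * v)⁻¹ * (Real.pi / ((1 - 2 * s * v) / (2 * v))) = (1 - 2 * s * v)⁻¹ := by
    field_simp
  rw [e, Real.sqrt_eq_rpow, Real.rpow_def_of_pos (by positivity), Real.log_inv]
  ring_nf

variable {Ω : Type*} [MeasurableSpace Ω]

theorem measure_sum_sq_gt_le {P : Measure Ω} [IsProbabilityMeasure P] {ι : Type*} [Fintype ι]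
    {ξ : ι → Ω → ℝ} (hm : ∀ i, Measurable (ξ i)) (hind : iIndepFun ξ P) {v : ι → NNReal}
    (hlaw : ∀ i, P.map (ξ i) = gaussianReal 0 (v i)) {A B ε : ℝ}
    (hA : ∑ i, (v i : ℝ) ≤ A) (hB0 : 0 ≤ B) (hB : ∑ i, (v i : ℝ) ^ 2 ≤ B ^ 2) (hε : 0 < ε) :
    P {ω | A + ε * B < ∑ i, ξ i ω ^ 2} ≤
      ENNReal.ofReal (Real.exp (-ε / 2) * Real.sqrt (ε + 1)) := by
  have hvB : ∀ i, (v i : ℝ) ≤ B := fun i => by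
    refine abs_le_of_sq_le_sq' (le_trans ?_ hB) hB0 |>.2
    exact Finset.single_le_sum (f := fun i => (v i : ℝ) ^ 2) (fun _ _ => sq_nonneg _)
      (Finset.mem_univ i)
  have hA0 : 0 ≤ A := le_trans (Finset.sum_nonneg fun i _ => (v i).2) hA
  rcases hB0.eq_or_lt with rfl | hBpos
  · have hv : ∀ i, v i = 0 := fun i => le_antisymm (by exact_mod_cast hvB i) bot_le
    have hz : ∀ i, ∀ᵐ ω ∂P, ξ i ω = 0 := fun i => by
      have h0 : ∀ᵐ x ∂(P.map (ξ i)), x = 0 := by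
        rw [hlaw, hv, gaussianReal_zero_var, ae_dirac_eq]
        simp
      exact ae_of_ae_map (hm i).aemeasurable h0
    have hz' : ∀ᵐ ω ∂P, ¬ (A + ε * 0 < ∑ i, ξ i ω ^ 2) := by
      filter_upwards [ae_all_iff.2 hz] with ω hω
      simp [hω, hA0]
    rw [show P {ω | A + ε * 0 < ∑ i, ξ i ω ^ 2} = 0 by simpa [ae_iff] using hz']
    exact bot_le
  set u : ℝ := ε / (ε + 1) with hu
  have hu0 : 0 < u := by positivity
  have hu1 : u < 1 := by rw [hu, div_lt_one (by positivity)]; linarith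
  set s : ℝ := u / (2 * B) with hs
  have hs0 : 0 < s := by positivity
  have hsB : 2 * s * B = u := by rw [hs]; field_simp
  have hx0 : ∀ i, 0 ≤ 2 * s * v i := fun i => by positivity
  have hxu : ∀ i, 2 * s * v i ≤ u := fun i => by
    rw [← hsB]; gcongr; exact hvB i
  have hx1 : ∀ i, 2 * s * v i < 1 := fun i => (hxu i).trans_lt hu1
  have hmeas : ∀ i, Measurable fun ω => ξ i ω ^ 2 := fun i => (hm i).pow_const 2
  have hind2 : iIndepFun (fun i ω => ξ i ω ^ 2) P :=
    hind.comp (fun _ x => x ^ 2) fun _ => measurable_id.pow_const 2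
  have hexp : Measurable fun x : ℝ => Real.exp (s * x ^ 2) := by fun_prop
  have hint : ∀ i, Integrable (fun ω => Real.exp (s * ξ i ω ^ 2)) P := fun i => by
    have h := integrable_exp_mul_sq_gaussianReal (hx1 i)
    rw [← hlaw i] at h
    exact h.comp_measurable (hm i)
  have hmgf : ∀ i, mgf (fun ω => ξ i ω ^ 2) P s = Real.exp (-Real.log (1 - 2 * s * v i) / 2) := by
    intro i
    rw [← integral_exp_mul_sq_gaussianReal (hx1 i), ← hlaw i,
      integral_map (hm i).aemeasurable hexp.aestronglyMeasurable]
    rfl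
  have hsum : (∑ i, fun ω => ξ i ω ^ 2) = fun ω => ∑ i, ξ i ω ^ 2 := by
    ext ω; simp
  set H : ℝ := -Real.log (1 - u) - u with hH
  have hbound : ∀ i, -Real.log (1 - 2 * s * v i) / 2 ≤ s * v i + (v i : ℝ) ^ 2 / B ^ 2 * H / 2 := by
    intro i
    have h := neg_log_one_sub_sub_mul_sq_le (hx0 i) (hxu i) hu1
    rw [← hH] at h
    have h2 : -Real.log (1 - 2 * s * v i) - 2 * s * v i ≤ (v i : ℝ) ^ 2 / B ^ 2 * H := by
      rw [← mul_le_mul_iff_left₀ (show 0 < u ^ 2 by positivity)]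
      refine h.trans_eq ?_
      rw [← hsB]
      field_simp
    linarith
  have hH0 : 0 ≤ H := by
    have h := neg_log_one_sub_sub_mul_sq_le le_rfl hu0.le hu1
    have h2 := Real.log_le_sub_one_of_pos (show 0 < 1 - u by linarith)
    rw [hH]; linarith
  have hmgf_le : mgf (∑ i, fun ω => ξ i ω ^ 2) P s ≤ Real.exp (s * A + H / 2) := by
    rw [hind2.mgf_sum hmeas, Finset.prod_congr rfl fun i _ => hmgf i, ← Real.exp_sum]
    refine Real.exp_le_exp.2 ((Finset.sum_le_sum fun i _ => hbound i).trans ?_)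
    rw [Finset.sum_add_distrib, ← Finset.mul_sum, ← Finset.sum_div, ← Finset.sum_mul,
      ← Finset.sum_div]
    have h1 : (∑ i, (v i : ℝ) ^ 2) / B ^ 2 ≤ 1 := (div_le_one (by positivity)).2 hB
    have h2 := mul_le_mul_of_nonneg_right h1 hH0
    have h3 := mul_le_mul_of_nonneg_left hA hs0.le
    linarith
  have hcher := measure_ge_le_exp_mul_mgf (μ := P) (X := ∑ i, fun ω => ξ i ω ^ 2) (A + ε * B) hs0.le
    (hind2.integrable_exp_mul_sum hmeas fun i _ => hint i)
  rw [hsum] at hcher hmgf_le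
  calc P {ω | A + ε * B < ∑ i, ξ i ω ^ 2}
      ≤ P {ω | A + ε * B ≤ ∑ i, ξ i ω ^ 2} := measure_mono (Set.ofPred_subset_ofPred.2 fun ω hω => hω.le)
    _ = ENNReal.ofReal (P.real {ω | A + ε * B ≤ ∑ i, ξ i ω ^ 2}) := by simp
    _ ≤ _ := ENNReal.ofReal_le_ofReal (hcher.trans ?_)
  refine (mul_le_mul_of_nonneg_left hmgf_le (Real.exp_nonneg _)).trans_eq ?_
  have h1u : 1 - u = (ε + 1)⁻¹ := by rw [hu]; field_simp; ring
  have hue : u * ε + u = ε := by rw [hu]; field_simp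
  rw [Real.sqrt_eq_rpow, Real.rpow_def_of_pos (by positivity), ← Real.exp_add, ← Real.exp_add, hH,
    h1u, Real.log_inv]
  congr 1
  linear_combination (-ε / 2) * hsB - hue / 2

end SphereTime

namespace SphereTime

/-! ### Orthogonality of spherical harmonics of different degrees -/

local notation "E3" => EuclideanSpace ℝ (Fin 3)

theorem exists_abs_eval_le (p : MvPolynomial (Fin 3) ℝ) :
    ∃ (C : ℝ) (n : ℕ), 0 ≤ C ∧
      ∀ x : E3, |MvPolynomial.eval (fun i => x i) p| ≤ C * (1 + ‖x‖) ^ n := by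
  induction p using MvPolynomial.induction_on with
  | C a => exact ⟨|a|, 0, abs_nonneg a, fun x => by simp⟩
  | add p q hp hq =>
    obtain ⟨C, n, hC, h⟩ := hp
    obtain ⟨D, m, hD, h'⟩ := hq
    refine ⟨C + D, n + m, by positivity, fun x => ?_⟩
    have h1 : 1 ≤ 1 + ‖x‖ := by simp
    rw [map_add, add_mul]
    refine (abs_add_le _ _).trans (add_le_add ((h x).trans ?_) ((h' x).trans ?_))
    · exact mul_le_mul_of_nonneg_left (pow_le_pow_right₀ h1 (by omega)) (by assumption)
    · exact mul_le_mul_of_nonneg_left (pow_le_pow_right₀ h1 (by omega)) (by assumption)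
  | mul_X p i hp =>
    obtain ⟨C, n, hC, h⟩ := hp
    refine ⟨C, n + 1, hC, fun x => ?_⟩
    have h1 : |x i| ≤ 1 + ‖x‖ := by
      have := PiLp.norm_apply_le x i
      rw [Real.norm_eq_abs] at this
      linarith
    rw [map_mul, MvPolynomial.eval_X, abs_mul, pow_succ, ← mul_assoc]
    exact mul_le_mul (h x) h1 (abs_nonneg _) (by positivity)

theorem continuous_eval_euclidean (p : MvPolynomial (Fin 3) ℝ) :
    Continuous fun x : E3 => MvPolynomial.eval (fun i => x i) p :=
  p.continuous_eval.comp (by fun_prop)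

theorem integrable_eval_mul_exp (p : MvPolynomial (Fin 3) ℝ) :
    Integrable fun x : E3 => MvPolynomial.eval (fun i => x i) p * Real.exp (-‖x‖ ^ 2 / 2) := by
  obtain ⟨C, n, hC, h⟩ := exists_abs_eval_le p
  have hint := (integrable_one_add_norm (E := E3) (μ := volume) (r := 4)
    (by rw [finrank_euclideanSpace_fin]; norm_num)).const_mul
      (C * ((n + 4).factorial * Real.exp (3 / 2)))
  refine hint.mono' ((continuous_eval_euclidean p).mul (by fun_prop)).aestronglyMeasurable
    (ae_of_all _ fun x => ?_)
  have h1 : 0 < 1 + ‖x‖ := by positivity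
  have h2 := Real.pow_div_factorial_le_exp (1 + ‖x‖) h1.le (n + 4)
  rw [div_le_iff₀ (by positivity)] at h2
  have h3 : Real.exp (1 + ‖x‖) * Real.exp (-‖x‖ ^ 2 / 2) ≤ Real.exp (3 / 2) := by
    rw [← Real.exp_add, Real.exp_le_exp]
    nlinarith [sq_nonneg (‖x‖ - 1)]
  have h4 : (1 + ‖x‖) ^ n * Real.exp (-‖x‖ ^ 2 / 2) ≤
      (n + 4).factorial * Real.exp (3 / 2) * (1 + ‖x‖) ^ (-4 : ℝ) := by
    rw [Real.rpow_neg h1.le, ← div_eq_mul_inv, le_div_iff₀ (by positivity)]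
    norm_cast
    calc (1 + ‖x‖) ^ n * Real.exp (-‖x‖ ^ 2 / 2) * (1 + ‖x‖) ^ 4
        = (1 + ‖x‖) ^ (n + 4) * Real.exp (-‖x‖ ^ 2 / 2) := by ring
      _ ≤ Real.exp (1 + ‖x‖) * (n + 4).factorial * Real.exp (-‖x‖ ^ 2 / 2) := by gcongr
      _ = (n + 4).factorial * (Real.exp (1 + ‖x‖) * Real.exp (-‖x‖ ^ 2 / 2)) := by ring
      _ ≤ _ := by gcongr
  rw [Real.norm_eq_abs, abs_mul, Real.abs_exp]
  calc _ ≤ C * (1 + ‖x‖) ^ n * Real.exp (-‖x‖ ^ 2 / 2) := by gcongr; exact h x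
    _ = C * ((1 + ‖x‖) ^ n * Real.exp (-‖x‖ ^ 2 / 2)) := by ring
    _ ≤ C * ((n + 4).factorial * Real.exp (3 / 2) * (1 + ‖x‖) ^ (-4 : ℝ)) := by gcongr
    _ = _ := by ring

theorem hasLineDerivAt_eval (p : MvPolynomial (Fin 3) ℝ) (i : Fin 3) (x : E3) :
    HasLineDerivAt ℝ (fun x : E3 => MvPolynomial.eval (fun i => x i) p)
      (MvPolynomial.eval (fun i => x i) (MvPolynomial.pderiv i p)) x
      (EuclideanSpace.single i 1) := by
  unfold HasLineDerivAt
  induction p using MvPolynomial.induction_on with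
  | C a => simpa using hasDerivAt_const (0 : ℝ) a
  | add p q hp hq =>
    simp only [map_add]
    exact hp.add hq
  | mul_X p j hp =>
    have h : HasDerivAt (fun t : ℝ => x j + t * (EuclideanSpace.single i 1 : E3) j)
        ((EuclideanSpace.single i 1 : E3) j) 0 := by
      simpa using ((hasDerivAt_id (0 : ℝ)).mul_const
        ((EuclideanSpace.single i 1 : E3) j)).const_add (x j)
    have h2 := hp.mul h
    simp only [map_mul, MvPolynomial.eval_X, PiLp.add_apply, PiLp.smul_apply, smul_eq_mul,
      MvPolynomial.pderiv_mul, map_add, MvPolynomial.pderiv_X]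
    refine HasDerivAt.congr_deriv (f := fun t : ℝ => _) h2 ?_
    by_cases hij : i = j
    · subst hij; simp
    · simp [hij, eq_comm]

theorem hasLineDerivAt_exp_neg_norm_sq (i : Fin 3) (x : E3) :
    HasLineDerivAt ℝ (fun x : E3 => Real.exp (-‖x‖ ^ 2 / 2))
      (-(x i * Real.exp (-‖x‖ ^ 2 / 2))) x (EuclideanSpace.single i 1) := by
  unfold HasLineDerivAt
  have h : HasDerivAt (fun t : ℝ => x + t • (EuclideanSpace.single i 1 : E3))
      (EuclideanSpace.single i 1) 0 := by
    simpa using ((hasDerivAt_id (0 : ℝ)).smul_const (EuclideanSpace.single i 1 : E3)).const_add x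
  have h2 := (h.norm_sq.neg.div_const 2).exp
  refine HasDerivAt.congr_deriv (f := fun t : ℝ => _) h2 ?_
  simp [EuclideanSpace.inner_single_right]
  ring

/-- Integration of a polynomial against the Gaussian weight on `ℝ³`. -/
noncomputable def gaussInt (p : MvPolynomial (Fin 3) ℝ) : ℝ :=
  ∫ x : E3, MvPolynomial.eval (fun i => x i) p * Real.exp (-‖x‖ ^ 2 / 2)

theorem gaussInt_add (p q : MvPolynomial (Fin 3) ℝ) :
    gaussInt (p + q) = gaussInt p + gaussInt q := by
  unfold gaussInt
  rw [← integral_add (integrable_eval_mul_exp p) (integrable_eval_mul_exp q)]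
  simp [add_mul]

theorem gaussInt_smul (r : ℝ) (p : MvPolynomial (Fin 3) ℝ) : gaussInt (r • p) = r * gaussInt p := by
  unfold gaussInt
  rw [← integral_const_mul]
  simp [mul_assoc]

theorem gaussInt_sum (f : Fin 3 → MvPolynomial (Fin 3) ℝ) :
    gaussInt (∑ i, f i) = ∑ i, gaussInt (f i) :=
  map_sum (⟨⟨gaussInt, by simp [gaussInt]⟩, gaussInt_add⟩ : MvPolynomial (Fin 3) ℝ →+ ℝ) f _

theorem gaussInt_X_mul (i : Fin 3) (q : MvPolynomial (Fin 3) ℝ) :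
    gaussInt (MvPolynomial.X i * q) = gaussInt (MvPolynomial.pderiv i q) := by
  have hX : ∀ x : E3, MvPolynomial.eval (fun i => x i) q * -(x i * Real.exp (-‖x‖ ^ 2 / 2)) =
      -(MvPolynomial.eval (fun i => x i) (MvPolynomial.X i * q) * Real.exp (-‖x‖ ^ 2 / 2)) := by
    intro x; simp; ring
  have h := integral_bilinear_hasLineDerivAt_right_eq_neg_left_of_integrable
    (μ := (volume : Measure E3)) (B := ContinuousLinearMap.mul ℝ ℝ)
    (f := fun x => MvPolynomial.eval (fun i => x i) q)
    (f' := fun x => MvPolynomial.eval (fun i => x i) (MvPolynomial.pderiv i q))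
    (g := fun x => Real.exp (-‖x‖ ^ 2 / 2)) (g' := fun x => -(x i * Real.exp (-‖x‖ ^ 2 / 2)))
    (v := EuclideanSpace.single i 1)
    (integrable_eval_mul_exp _)
    (by simp only [ContinuousLinearMap.mul_apply', hX]; exact (integrable_eval_mul_exp _).neg)
    (integrable_eval_mul_exp _)
    (fun x _ => hasLineDerivAt_eval q i x) (fun x _ => hasLineDerivAt_exp_neg_norm_sq i x)
  simp only [ContinuousLinearMap.mul_apply', hX, integral_neg, neg_inj] at h
  exact h

theorem natCast_mul_gaussInt_mul {p q : MvPolynomial (Fin 3) ℝ} {j : ℕ} (hp : p.IsHomogeneous j)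
    (hΔ : ∑ i, MvPolynomial.pderiv i (MvPolynomial.pderiv i p) = 0) :
    j * gaussInt (p * q) = ∑ i, gaussInt (MvPolynomial.pderiv i p * MvPolynomial.pderiv i q) := by
  have h1 : (j : ℝ) • (p * q) = ∑ i, MvPolynomial.X i * (MvPolynomial.pderiv i p * q) := by
    simp_rw [← mul_assoc]
    rw [← Finset.sum_mul, hp.sum_X_mul_pderiv, Nat.cast_smul_eq_nsmul, smul_mul_assoc]
  rw [← gaussInt_smul, h1, gaussInt_sum]
  simp_rw [gaussInt_X_mul, MvPolynomial.pderiv_mul, gaussInt_add]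
  rw [Finset.sum_add_distrib, ← gaussInt_sum, ← Finset.sum_mul, hΔ]
  simp [gaussInt]

theorem gaussInt_mul_eq_zero {p q : MvPolynomial (Fin 3) ℝ} {j j' : ℕ} (hj : j ≠ j')
    (hp : p.IsHomogeneous j) (hΔp : ∑ i, MvPolynomial.pderiv i (MvPolynomial.pderiv i p) = 0)
    (hq : q.IsHomogeneous j') (hΔq : ∑ i, MvPolynomial.pderiv i (MvPolynomial.pderiv i q) = 0) :
    gaussInt (p * q) = 0 := by
  have h1 := natCast_mul_gaussInt_mul (q := q) hp hΔp
  have h2 := natCast_mul_gaussInt_mul (q := p) hq hΔq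
  simp_rw [mul_comm q p, mul_comm (MvPolynomial.pderiv _ q)] at h2
  have h3 : ((j : ℝ) - j') * gaussInt (p * q) = 0 := by linear_combination h1 - h2
  refine (mul_eq_zero.1 h3).resolve_left (sub_ne_zero.2 ?_)
  exact_mod_cast hj

theorem eval_smul_of_isHomogeneous {p : MvPolynomial (Fin 3) ℝ} {n : ℕ} (hp : p.IsHomogeneous n)
    (r : ℝ) (x : E3) : MvPolynomial.eval (fun i => (r • x) i) p =
      r ^ n * MvPolynomial.eval (fun i => x i) p := by
  rw [MvPolynomial.eval_eq', MvPolynomial.eval_eq', Finset.mul_sum]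
  refine Finset.sum_congr rfl fun d hd => ?_
  have hdeg : ∑ i, d i = n := by
    have := hp (MvPolynomial.mem_support_iff.1 hd)
    simpa [Finsupp.weight_apply, Finsupp.sum_fintype] using this
  simp only [PiLp.smul_apply, smul_eq_mul, mul_pow, Finset.prod_mul_distrib, Finset.prod_pow_eq_pow_sum,
    hdeg]
  ring

theorem gaussInt_eq_mul_integral_surface {p : MvPolynomial (Fin 3) ℝ} {n : ℕ}
    (hp : p.IsHomogeneous n) : ∃ R : ℝ, R ≠ 0 ∧
      gaussInt p = (∫ x : S2, MvPolynomial.eval (fun i => x.1 i) p ∂surface) * R := by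
  refine ⟨∫ r : Ioi (0 : ℝ), r.1 ^ n * Real.exp (-r.1 ^ 2 / 2) ∂(Measure.volumeIoiPow 2), ?_, ?_⟩
  · simp only [Measure.volumeIoiPow, ENNReal.ofReal]
    rw [integral_withDensity_eq_integral_smul
      (measurable_subtype_coe.pow_const _).real_toNNReal,
      integral_subtype_comap measurableSet_Ioi
        fun a : ℝ => Real.toNNReal (a ^ 2) • (a ^ n * Real.exp (-a ^ 2 / 2)),
      setIntegral_congr_fun (g := fun x : ℝ => x ^ ((n + 2 : ℕ) : ℝ) *
        Real.exp (-(1 / 2) * x ^ (2 : ℝ))) measurableSet_Ioi fun x hx => ?_,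
      integral_rpow_mul_exp_neg_mul_rpow (by norm_num) (by
        have : (0 : ℝ) ≤ ((n + 2 : ℕ) : ℝ) := by positivity
        linarith) (by norm_num)]
    · have : 0 < Real.Gamma ((((n + 2 : ℕ) : ℝ) + 1) / 2) := Real.Gamma_pos_of_pos (by positivity)
      positivity
    · simp only [NNReal.smul_def, smul_eq_mul]
      rw [Real.coe_toNNReal _ (by positivity), Real.rpow_natCast, Real.rpow_two]
      ring_nf
  · have hmp := (volume : Measure E3).measurePreserving_homeomorphUnitSphereProd
    rw [finrank_euclideanSpace_fin] at hmp
    rw [gaussInt, ← restrict_compl_singleton (μ := volume) (0 : E3),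
      ← integral_subtype_comap (measurableSet_singleton _).compl
        fun x : E3 => MvPolynomial.eval (fun i => x i) p * Real.exp (-‖x‖ ^ 2 / 2)]
    rw [surface, ← integral_prod_mul (fun x : S2 => MvPolynomial.eval (fun i => x.1 i) p)
      fun r : Ioi (0 : ℝ) => r.1 ^ n * Real.exp (-r.1 ^ 2 / 2)]
    refine Eq.trans ?_ (hmp.integral_comp (Homeomorph.measurableEmbedding _) _)
    refine integral_congr_ae (ae_of_all _ fun x => ?_)
    have hx : (x : E3) = ‖(x : E3)‖ • ((homeomorphUnitSphereProd E3 x).1 : E3) := by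
      have h := congrArg Subtype.val ((homeomorphUnitSphereProd E3).symm_apply_apply x)
      rw [homeomorphUnitSphereProd_symm_apply_coe] at h
      simpa using h.symm
    have hn : ((homeomorphUnitSphereProd E3 x).2 : ℝ) = ‖(x : E3)‖ := by simp
    have hev : MvPolynomial.eval (fun i => (x : E3) i) p = ‖(x : E3)‖ ^ n *
        MvPolynomial.eval (fun i => ((homeomorphUnitSphereProd E3 x).1 : E3) i) p := by
      conv_lhs => rw [hx]
      exact eval_smul_of_isHomogeneous hp _ _
    simp only [hn, hev]
    ring

theorem IsSphericalHarmonic.integral_mul_eq_zero {j j' : ℕ} {f g : S2 → ℝ}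
    (hf : IsSphericalHarmonic j f) (hg : IsSphericalHarmonic j' g) (hj : j ≠ j') :
    ∫ x, f x * g x ∂surface = 0 := by
  obtain ⟨p, hp, hΔp, hfp⟩ := hf
  obtain ⟨q, hq, hΔq, hgq⟩ := hg
  obtain ⟨R, hR, h⟩ := gaussInt_eq_mul_integral_surface (hp.mul hq)
  rw [gaussInt_mul_eq_zero hj hp hΔp hq hΔq] at h
  simpa [hfp, hgq, hR] using h.symm

theorem IsSphericalHarmonic.continuous {j : ℕ} {f : S2 → ℝ} (hf : IsSphericalHarmonic j f) :
    Continuous f := by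
  obtain ⟨p, -, -, hfp⟩ := hf
  rw [funext hfp]
  exact (continuous_eval_euclidean p).comp continuous_subtype_val

instance : IsFiniteMeasure surface := by unfold surface; infer_instance

theorem IsHarmonicBasis.integral_mul {Y : Index → S2 → ℝ} (hY : IsHarmonicBasis Y) (i i' : Index) :
    ∫ x, Y i x * Y i' x ∂surface = if i = i' then 1 else 0 := by
  obtain ⟨j, m⟩ := i
  obtain ⟨j', m'⟩ := i'
  by_cases hj : j = j'
  · subst hj
    simpa using hY.orthonormal j m m'
  · rw [(hY.harmonic ⟨j, m⟩).integral_mul_eq_zero (hY.harmonic ⟨j', m'⟩) hj, if_neg]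
    simp [hj]

end SphereTime

namespace SphereTime

/-! ### Gaussian Hilbert spaces -/

section GaussianHilbert

variable {Ω : Type*} [MeasurableSpace Ω] {P : Measure Ω}

theorem charFun_map_eq_integral (f : Lp ℝ 2 P) (t : ℝ) :
    charFun (P.map f) t = ∫ ω, Complex.exp (Complex.I * ((t * f ω : ℝ) : ℂ)) ∂P := by
  rw [charFun_apply_real, integral_map (Lp.aestronglyMeasurable f).aemeasurable (by fun_prop)]
  congr with ω
  push_cast
  ring_nf

theorem norm_exp_I_mul_sub_le (a b : ℝ) :
    ‖Complex.exp (Complex.I * a) - Complex.exp (Complex.I * b)‖ ≤ |a - b| := by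
  have h : Complex.exp (Complex.I * a) - Complex.exp (Complex.I * b) =
      Complex.exp (Complex.I * b) * (Complex.exp (Complex.I * ((a - b : ℝ) : ℂ)) - 1) := by
    rw [mul_sub, ← Complex.exp_add]
    push_cast
    ring_nf
  rw [h, norm_mul, Complex.norm_exp_I_mul_ofReal, one_mul]
  exact Real.norm_exp_I_mul_ofReal_sub_one_le

theorem coeFn_sum_ae {ι : Type*} (s : Finset ι) (f : ι → Lp ℝ 2 P) :
    (∑ i ∈ s, f i : Lp ℝ 2 P) =ᵐ[P] fun ω => ∑ i ∈ s, f i ω := by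
  classical
  induction s using Finset.induction_on with
  | empty => simp only [Finset.sum_empty]; exact Lp.coeFn_zero ℝ 2 P
  | insert i s hi ih =>
    rw [Finset.sum_insert hi]
    filter_upwards [Lp.coeFn_add (f i) (∑ i ∈ s, f i), ih] with ω h1 h2
    rw [h1, Finset.sum_insert hi, Pi.add_apply, h2]

theorem coeFn_sum_smul_ae {ι : Type*} (s : Finset ι) (c : ι → ℝ) (f : ι → Lp ℝ 2 P) :
    (∑ i ∈ s, c i • f i : Lp ℝ 2 P) =ᵐ[P] fun ω => ∑ i ∈ s, c i * f i ω := by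
  have h : ∀ᵐ ω ∂P, ∀ i ∈ s, (c i • f i : Lp ℝ 2 P) ω = c i * f i ω :=
    (ae_ball_iff s.countable_toSet).2 fun i _ => Lp.coeFn_smul (c i) (f i)
  filter_upwards [coeFn_sum_ae s fun i => c i • f i, h] with ω h1 h2
  rw [h1, Finset.sum_congr rfl h2]

theorem norm_sq_eq_integral_sq (f : Lp ℝ 2 P) : ‖f‖ ^ 2 = ∫ ω, f ω ^ 2 ∂P := by
  rw [← real_inner_self_eq_norm_sq, L2.inner_def]
  simp [sq]

/-- A family in the closed linear span of a centred Gaussian process is jointly Gaussian. -/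
theorem hasGaussianLaw_of_forall_mem {V : Submodule ℝ (Lp ℝ 2 P)}
    (hV : ∀ f ∈ V, P.map f = gaussianReal 0 (‖f‖₊ ^ 2)) {ι : Type*} [Fintype ι]
    {F : ι → Ω → ℝ} (hF : ∀ i, MemLp (F i) 2 P) (hFV : ∀ i, (hF i).toLp (F i) ∈ V) :
    HasGaussianLaw (fun ω i => F i ω) P := by
  classical
  refine ⟨isGaussian_of_map_eq_gaussianReal fun L => ?_⟩
  have hm : AEMeasurable (fun ω i => F i ω) P :=
    aemeasurable_pi_lambda _ fun i => (hF i).aestronglyMeasurable.aemeasurable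
  set f : Lp ℝ 2 P := ∑ i, L (Pi.single i 1) • (hF i).toLp (F i)
  refine ⟨0, ‖f‖₊ ^ 2, ?_⟩
  rw [AEMeasurable.map_map_of_aemeasurable L.continuous.aemeasurable hm,
    ← hV f (V.sum_mem fun i _ => V.smul_mem _ (hFV i))]
  refine Measure.map_congr ?_
  have h : ∀ᵐ ω ∂P, ∀ i, (hF i).toLp (F i) ω = F i ω :=
    ae_all_iff.2 fun i => (hF i).coeFn_toLp
  filter_upwards [coeFn_sum_smul_ae Finset.univ (fun i => L (Pi.single i 1))
    fun i => (hF i).toLp (F i), h] with ω h1 h2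
  rw [h1, Function.comp_apply]
  have hx : (fun i => F i ω) = ∑ i, F i ω • (Pi.single i 1 : ι → ℝ) := by
    ext i
    simp [Finset.sum_apply, Pi.single_apply]
  rw [hx, map_sum]
  refine Finset.sum_congr rfl fun i _ => ?_
  rw [map_smul, h2, smul_eq_mul, mul_comm]

variable [IsProbabilityMeasure P]

theorem integral_abs_le_norm (f : Lp ℝ 2 P) : ∫ ω, |f ω| ∂P ≤ ‖f‖ := by
  have h1 : ∫ ω, |f ω| ∂P = (eLpNorm f 1 P).toReal := by
    rw [eLpNorm_one_eq_lintegral_enorm, integral_eq_lintegral_of_nonneg_ae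
      (ae_of_all _ fun _ => abs_nonneg _) (Lp.aestronglyMeasurable f).norm]
    congr 1
    refine lintegral_congr fun ω => ?_
    rw [← Real.norm_eq_abs, ofReal_norm]
  rw [h1, Lp.norm_def]
  exact ENNReal.toReal_mono (Lp.memLp f).eLpNorm_ne_top
    (eLpNorm_le_eLpNorm_of_exponent_le one_le_two (Lp.aestronglyMeasurable f))

theorem continuous_charFun_map (t : ℝ) : Continuous fun f : Lp ℝ 2 P => charFun (P.map f) t := by
  have hint : ∀ f : Lp ℝ 2 P,
      Integrable (fun ω => Complex.exp (Complex.I * ((t * f ω : ℝ) : ℂ))) P := fun f =>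
    (integrable_const (1 : ℝ)).mono'
      ((show Continuous fun x : ℝ => Complex.exp (Complex.I * ((t * x : ℝ) : ℂ)) by
        fun_prop).comp_aestronglyMeasurable (Lp.aestronglyMeasurable f))
      (ae_of_all _ fun ω => (Complex.norm_exp_I_mul_ofReal _).le)
  refine (LipschitzWith.of_dist_le_mul (K := ‖t‖₊) fun f g => ?_).continuous
  rw [dist_eq_norm, dist_eq_norm, charFun_map_eq_integral, charFun_map_eq_integral,
    ← integral_sub (hint f) (hint g)]
  have hfg : Integrable (fun ω => |(f - g : Lp ℝ 2 P) ω|) P :=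
    ((Lp.memLp (f - g)).integrable one_le_two).abs
  calc _ ≤ ∫ ω, |t| * |(f - g : Lp ℝ 2 P) ω| ∂P := by
        refine norm_integral_le_of_norm_le (hfg.const_mul _) ?_
        filter_upwards [Lp.coeFn_sub f g] with ω hω
        refine (norm_exp_I_mul_sub_le _ _).trans_eq ?_
        rw [hω, Pi.sub_apply, ← mul_sub, abs_mul]
    _ ≤ _ := by
        rw [integral_const_mul]
        exact mul_le_mul_of_nonneg_left (integral_abs_le_norm _) (abs_nonneg _)

theorem isClosed_setOf_map_eq_gaussianReal :
    IsClosed {f : Lp ℝ 2 P | P.map f = gaussianReal 0 (‖f‖₊ ^ 2)} := by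
  have h : {f : Lp ℝ 2 P | P.map f = gaussianReal 0 (‖f‖₊ ^ 2)} =
      ⋂ t : ℝ, {f : Lp ℝ 2 P | charFun (P.map f) t = charFun (gaussianReal 0 (‖f‖₊ ^ 2)) t} := by
    ext f
    have : IsProbabilityMeasure (P.map f) :=
      Measure.isProbabilityMeasure_map (Lp.aestronglyMeasurable f).aemeasurable
    simp only [Set.mem_iInter, Set.mem_ofPred_eq]
    exact ⟨fun h t => by rw [h], fun h => Measure.ext_of_charFun (funext h)⟩
  rw [h]
  refine isClosed_iInter fun t => isClosed_eq (continuous_charFun_map t) ?_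
  simp_rw [charFun_gaussianReal]
  push_cast
  fun_prop

theorem map_eq_gaussianReal_of_mem_closure {V : Submodule ℝ (Lp ℝ 2 P)}
    (hV : ∀ f ∈ V, P.map f = gaussianReal 0 (‖f‖₊ ^ 2)) {f : Lp ℝ 2 P}
    (hf : f ∈ V.topologicalClosure) : P.map f = gaussianReal 0 (‖f‖₊ ^ 2) :=
  closure_minimal (t := {f : Lp ℝ 2 P | P.map f = gaussianReal 0 (‖f‖₊ ^ 2)})
    hV isClosed_setOf_map_eq_gaussianReal hf

theorem map_eq_gaussianReal_of_mem_span {ι : Type*} {G : ι → Lp ℝ 2 P}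
    (hG : IsGaussianProcess (fun i => (G i : Ω → ℝ)) P) (h0 : ∀ i, ∫ ω, G i ω ∂P = 0)
    {f : Lp ℝ 2 P} (hf : f ∈ Submodule.span ℝ (range G)) :
    P.map f = gaussianReal 0 (‖f‖₊ ^ 2) := by
  obtain ⟨c, rfl⟩ := Finsupp.mem_span_range_iff_exists_finsupp.1 hf
  set f := c.sum fun i a => a • G i with hfdef
  have hae : f =ᵐ[P] fun ω => ∑ i ∈ c.support, c i * G i ω := coeFn_sum_smul_ae c.support c G
  have hlaw : HasGaussianLaw f P := by
    have h := (hG.smul c).hasGaussianLaw_fun_sum (I := c.support)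
    simp only [smul_eq_mul] at h
    exact h.congr hae.symm
  have hmean : ∫ ω, f ω ∂P = 0 := by
    rw [integral_congr_ae hae, integral_finsetSum _ fun i _ =>
      ((Lp.memLp (G i)).integrable one_le_two).const_mul _]
    simp [integral_const_mul, h0]
  rw [hlaw.map_eq_gaussianReal, hmean, variance_of_integral_eq_zero
    (Lp.aestronglyMeasurable f).aemeasurable hmean, ← norm_sq_eq_integral_sq]
  congr 1
  ext
  simp

end GaussianHilbert

end SphereTime

namespace SphereTime

/-! ### Karhunen–Loève coefficients -/

instance (T : ℝ) : IsFiniteMeasure (timeMeasure T) := by unfold timeMeasure; infer_instance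

theorem timeMeasure_real_univ {T : ℝ} (hT : 0 < T) : (timeMeasure T).real univ = T := by
  simp [timeMeasure, hT.le]

theorem integral_sq_sub_basis_hasSum {T : ℝ} (b : HilbertBasis ℕ ℝ (TimeL2 T)) {g : ℝ → ℝ}
    (hg : MemLp g 2 (timeMeasure T)) (s : Finset ℕ) :
    HasSum (fun k => if k ∈ s then 0 else (∫ t, g t * (b k : TimeL2 T) t ∂(timeMeasure T)) ^ 2)
      (∫ t, (g t - ∑ k ∈ s, (∫ t, g t * (b k : TimeL2 T) t ∂(timeMeasure T)) *
        (b k : TimeL2 T) t) ^ 2 ∂(timeMeasure T)) := by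
  set d : ℕ → ℝ := fun k => ∫ t, g t * (b k : TimeL2 T) t ∂(timeMeasure T) with hd
  have hinner : ∀ k, inner ℝ (b k) (hg.toLp g) = d k := fun k => by
    rw [L2.inner_def]
    refine integral_congr_ae ?_
    filter_upwards [hg.coeFn_toLp] with t ht
    simp [ht]
  set h : TimeL2 T := hg.toLp g - ∑ k ∈ s, d k • b k
  have hh : ∀ k, inner ℝ (b k) h = if k ∈ s then 0 else d k := fun k => by
    simp only [h, inner_sub_right, hinner, inner_sum, inner_smul_right,
      orthonormal_iff_ite.mp b.orthonormal]
    by_cases hk : k ∈ s <;> simp [hk]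
  have hnorm := b.hasSum_inner_mul_inner h h
  simp_rw [real_inner_comm (b _) h, hh, real_inner_self_eq_norm_sq, norm_sq_eq_integral_sq] at hnorm
  have hfun : (fun k => (if k ∈ s then 0 else d k) * if k ∈ s then 0 else d k) =
      fun k => if k ∈ s then 0 else d k ^ 2 := by
    ext k; split_ifs <;> ring
  rw [hfun] at hnorm
  suffices e : ∫ t, (g t - ∑ k ∈ s, d k * (b k : TimeL2 T) t) ^ 2 ∂(timeMeasure T) =
      ∫ t, h t ^ 2 ∂(timeMeasure T) by rw [e]; exact hnorm
  refine integral_congr_ae ?_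
  filter_upwards [hg.coeFn_toLp, Lp.coeFn_sub (hg.toLp g) (∑ k ∈ s, d k • b k),
    coeFn_sum_smul_ae s d fun k => (b k : TimeL2 T)] with t h1 h2 h3
  simp only [h, h2, Pi.sub_apply, h1, h3]

variable {Ω : Type*} [MeasurableSpace Ω] {P : Measure Ω}
  {φ : ℕ → ℝ → ℝ} {X : Index → ℝ → Ω → ℝ} {T : ℝ}

namespace IsCoefficientProcess

theorem memLp_eval (hX : IsCoefficientProcess P φ X) (i : Index) (t : ℝ) : MemLp (X i t) 2 P :=
  (hX.gaussian.hasGaussianLaw_eval (i, t)).memLp_two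

theorem integral_sq (hX : IsCoefficientProcess P φ X) (i : Index) (t : ℝ) :
    ∫ ω, X i t ω ^ 2 ∂P = φ i.1 0 := by
  have h := hX.covariance i i t t
  simpa [sq] using h

theorem measurable_swap (hX : IsCoefficientProcess P φ X) (i : Index) :
    Measurable fun p : Ω × ℝ => X i p.2 p.1 :=
  (hX.measurable i).comp _root_.measurable_swap

theorem measurable_klCoeff (hX : IsCoefficientProcess P φ X)
    (ζ : ℕ → HilbertBasis ℕ ℝ (TimeL2 T)) (k : ℕ) (i : Index) : Measurable (klCoeff T X ζ k i) := by
  unfold klCoeff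
  refine (StronglyMeasurable.integral_prod_right (f := fun ω t => X i t ω *
    (ζ i.1 k : TimeL2 T) t) ?_).measurable
  exact (hX.measurable_swap i).stronglyMeasurable.mul
    ((Lp.stronglyMeasurable (ζ i.1 k)).comp_measurable measurable_snd)

variable [IsProbabilityMeasure P]

theorem memLp_prod (hX : IsCoefficientProcess P φ X) (i : Index) :
    MemLp (fun p : Ω × ℝ => X i p.2 p.1) 2 (P.prod (timeMeasure T)) := by
  have hm := (hX.measurable_swap i).aestronglyMeasurable (μ := P.prod (timeMeasure T))
  rw [memLp_two_iff_integrable_sq hm, integrable_prod_iff' (hm.fun_pow 2)]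
  refine ⟨ae_of_all _ fun t => (hX.memLp_eval i t).integrable_sq, ?_⟩
  simp [hX.integral_sq]

theorem memLp_path (hX : IsCoefficientProcess P φ X) (i : Index) :
    ∀ᵐ ω ∂P, MemLp (fun t => X i t ω) 2 (timeMeasure T) := by
  filter_upwards [(hX.memLp_prod (T := T) i).integrable_sq.prod_right_ae] with ω hω
  exact (memLp_two_iff_integrable_sq
    ((hX.measurable_swap i).comp measurable_prodMk_left).aestronglyMeasurable).2 hω

theorem integral_mul_integral (hX : IsCoefficientProcess P φ X) (i : Index) {U : Ω → ℝ}
    (hU : MemLp U 2 P) {g : ℝ → ℝ} (hg : MemLp g 2 (timeMeasure T)) :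
    ∫ ω, U ω * ∫ t, X i t ω * g t ∂(timeMeasure T) ∂P =
      ∫ t, (∫ ω, U ω * X i t ω ∂P) * g t ∂(timeMeasure T) := by
  have hUg : MemLp (fun p : Ω × ℝ => U p.1 * g p.2) 2 (P.prod (timeMeasure T)) := by
    rw [memLp_two_iff_integrable_sq
      (hU.aestronglyMeasurable.comp_fst.fun_mul hg.aestronglyMeasurable.comp_snd)]
    simp_rw [mul_pow]
    exact hU.integrable_sq.mul_prod hg.integrable_sq
  have hint : Integrable (Function.uncurry fun ω t => U ω * X i t ω * g t)
      (P.prod (timeMeasure T)) := by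
    refine (hUg.integrable_mul (hX.memLp_prod i)).congr (ae_of_all _ fun p => ?_)
    simp only [Pi.mul_apply, Function.uncurry]
    ring
  have h := integral_integral_swap hint
  simp_rw [integral_mul_const, mul_assoc, integral_const_mul] at h
  exact h

theorem klCoeff_sq_hasSum (hX : IsCoefficientProcess P φ X)
    (ζ : ℕ → HilbertBasis ℕ ℝ (TimeL2 T)) (i : Index) :
    ∀ᵐ ω ∂P, HasSum (fun k => klCoeff T X ζ k i ω ^ 2) (∫ t, X i t ω ^ 2 ∂(timeMeasure T)) := by
  filter_upwards [hX.memLp_path i] with ω hω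
  simpa [klCoeff] using integral_sq_sub_basis_hasSum (ζ i.1) hω ∅

theorem integrable_integral_sq (hX : IsCoefficientProcess P φ X) (i : Index) :
    Integrable (fun ω => ∫ t, X i t ω ^ 2 ∂(timeMeasure T)) P :=
  (hX.memLp_prod i).integrable_sq.integral_prod_left

theorem integral_integral_sq (hX : IsCoefficientProcess P φ X) (hT : 0 < T) (i : Index) :
    ∫ ω, ∫ t, X i t ω ^ 2 ∂(timeMeasure T) ∂P = T * φ i.1 0 := by
  rw [integral_integral_swap (hX.memLp_prod i).integrable_sq]
  simp [hX.integral_sq, timeMeasure_real_univ hT]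

theorem memLp_klCoeff (hX : IsCoefficientProcess P φ X)
    (ζ : ℕ → HilbertBasis ℕ ℝ (TimeL2 T)) (k : ℕ) (i : Index) :
    MemLp (klCoeff T X ζ k i) 2 P := by
  have hm := (hX.measurable_klCoeff ζ k i).aestronglyMeasurable (μ := P)
  rw [memLp_two_iff_integrable_sq hm]
  refine (hX.integrable_integral_sq (T := T) i).mono' (hm.pow 2) ?_
  filter_upwards [hX.klCoeff_sq_hasSum ζ i] with ω hω
  rw [Real.norm_of_nonneg (sq_nonneg _)]
  exact le_hasSum hω k fun _ _ => sq_nonneg _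

theorem integral_eval_mul_klCoeff (hX : IsCoefficientProcess P φ X) {a : ℕ → ℕ → ℝ}
    {ζ : ℕ → HilbertBasis ℕ ℝ (TimeL2 T)} (hζ : IsEigenSystem T φ a ζ) (k : ℕ) (i i' : Index) :
    ∀ᵐ s ∂(timeMeasure T), ∫ ω, klCoeff T X ζ k i ω * X i' s ω ∂P =
      if i = i' then a k i.1 * (ζ i.1 k : TimeL2 T) s else 0 := by
  filter_upwards [hζ i.1 k] with s hs
  have h := hX.integral_mul_integral i (hX.memLp_eval i' s) (Lp.memLp (ζ i.1 k))
  simp_rw [hX.covariance i' i] at h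
  simp_rw [mul_comm (klCoeff T X ζ k i _)]
  refine h.trans ?_
  by_cases hi : i = i'
  · subst hi; simpa using hs
  · simp [hi, Ne.symm hi]

theorem integral_klCoeff_mul_klCoeff (hX : IsCoefficientProcess P φ X) {a : ℕ → ℕ → ℝ}
    {ζ : ℕ → HilbertBasis ℕ ℝ (TimeL2 T)} (hζ : IsEigenSystem T φ a ζ) (k k' : ℕ) (i i' : Index) :
    ∫ ω, klCoeff T X ζ k i ω * klCoeff T X ζ k' i' ω ∂P =
      if i = i' ∧ k = k' then a k i.1 else 0 := by
  have h := hX.integral_mul_integral i' (hX.memLp_klCoeff ζ k i) (Lp.memLp (ζ i'.1 k'))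
  refine h.trans ?_
  have hae : ∀ᵐ s ∂(timeMeasure T), (∫ ω, klCoeff T X ζ k i ω * X i' s ω ∂P) *
      (ζ i'.1 k' : TimeL2 T) s = if i = i' then
        a k i.1 * ((ζ i'.1 k' : TimeL2 T) s * (ζ i.1 k : TimeL2 T) s) else 0 := by
    filter_upwards [hX.integral_eval_mul_klCoeff hζ k i i'] with s hs
    rw [hs]
    split_ifs <;> ring
  rw [integral_congr_ae hae]
  by_cases hi : i = i'
  · subst hi
    have horth := (orthonormal_iff_ite.1 (ζ i.1).orthonormal) k k'
    rw [L2.inner_def] at horth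
    simp only [RCLike.inner_apply, conj_trivial] at horth
    simp [integral_const_mul, horth]
  · simp [hi]

theorem integral_klCoeff_sq (hX : IsCoefficientProcess P φ X) {a : ℕ → ℕ → ℝ}
    {ζ : ℕ → HilbertBasis ℕ ℝ (TimeL2 T)} (hζ : IsEigenSystem T φ a ζ) (k : ℕ) (i : Index) :
    ∫ ω, klCoeff T X ζ k i ω ^ 2 ∂P = a k i.1 := by
  simpa [sq] using hX.integral_klCoeff_mul_klCoeff hζ k k i i

theorem eigenvalue_nonneg (hX : IsCoefficientProcess P φ X) {a : ℕ → ℕ → ℝ}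
    {ζ : ℕ → HilbertBasis ℕ ℝ (TimeL2 T)} (hζ : IsEigenSystem T φ a ζ) (k j : ℕ) : 0 ≤ a k j := by
  rw [← hX.integral_klCoeff_sq hζ k ⟨j, 0⟩]
  exact integral_nonneg fun _ => sq_nonneg _

theorem hasSum_eigenvalue (hX : IsCoefficientProcess P φ X) (hT : 0 < T) {a : ℕ → ℕ → ℝ}
    {ζ : ℕ → HilbertBasis ℕ ℝ (TimeL2 T)} (hζ : IsEigenSystem T φ a ζ) {j : ℕ}
    (ha : Summable fun k => a k j) : HasSum (fun k => a k j) (T * φ j 0) := by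
  have h := hasSum_integral_of_summable_integral_norm (μ := P)
    (F := fun k ω => klCoeff T X ζ k ⟨j, 0⟩ ω ^ 2)
    (fun k => (hX.memLp_klCoeff ζ k ⟨j, 0⟩).integrable_sq)
    (by simpa [hX.integral_klCoeff_sq hζ] using ha)
  simp_rw [hX.integral_klCoeff_sq hζ] at h
  rw [← hX.integral_integral_sq hT ⟨j, 0⟩]
  rwa [integral_congr_ae ((hX.klCoeff_sq_hasSum ζ ⟨j, 0⟩).mono fun ω hω => hω.tsum_eq)] at h

/-- The closed linear span in `L²` of the values of the coefficient processes. -/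
noncomputable def gaussianSpace (hX : IsCoefficientProcess P φ X) : Submodule ℝ (Lp ℝ 2 P) :=
  (Submodule.span ℝ (range fun q : Index × ℝ =>
    (hX.memLp_eval q.1 q.2).toLp (X q.1 q.2))).topologicalClosure

theorem map_eq_gaussianReal_of_mem_gaussianSpace (hX : IsCoefficientProcess P φ X) :
    ∀ f ∈ hX.gaussianSpace, P.map f = gaussianReal 0 (‖f‖₊ ^ 2) := fun f hf => by
  refine map_eq_gaussianReal_of_mem_closure (fun f hf => map_eq_gaussianReal_of_mem_span
    (hX.gaussian.congr fun q => (hX.memLp_eval q.1 q.2).coeFn_toLp.symm) (fun q => ?_) hf) hf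
  rw [integral_congr_ae (hX.memLp_eval q.1 q.2).coeFn_toLp]
  exact hX.centered q.1 q.2

theorem klCoeff_mem_gaussianSpace (hX : IsCoefficientProcess P φ X)
    (ζ : ℕ → HilbertBasis ℕ ℝ (TimeL2 T)) (k : ℕ) (i : Index) :
    (hX.memLp_klCoeff ζ k i).toLp (klCoeff T X ζ k i) ∈ hX.gaussianSpace := by
  rw [gaussianSpace, ← Submodule.orthogonal_orthogonal_eq_closure, Submodule.mem_orthogonal]
  intro U hU
  rw [Submodule.mem_orthogonal] at hU
  have hU' : ∀ t, ∫ ω, U ω * X i t ω ∂P = 0 := fun t => by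
    have h := hU _ (Submodule.subset_span ⟨(i, t), rfl⟩)
    rw [L2.inner_def] at h
    rw [← h]
    refine integral_congr_ae ?_
    filter_upwards [(hX.memLp_eval i t).coeFn_toLp] with ω hω
    simp [hω]
  rw [L2.inner_def]
  have h := hX.integral_mul_integral i (Lp.memLp U) (Lp.memLp (ζ i.1 k))
  simp only [hU', zero_mul, integral_zero] at h
  rw [← h]
  refine integral_congr_ae ?_
  filter_upwards [(hX.memLp_klCoeff ζ k i).coeFn_toLp] with ω hω
  simp [hω, klCoeff, mul_comm]

theorem map_klCoeff (hX : IsCoefficientProcess P φ X) {a : ℕ → ℕ → ℝ}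
    {ζ : ℕ → HilbertBasis ℕ ℝ (TimeL2 T)} (hζ : IsEigenSystem T φ a ζ) (k : ℕ) (i : Index) :
    P.map (klCoeff T X ζ k i) = gaussianReal 0 (a k i.1).toNNReal := by
  have hae := (hX.memLp_klCoeff ζ k i).coeFn_toLp
  rw [← Measure.map_congr hae,
    hX.map_eq_gaussianReal_of_mem_gaussianSpace _ (hX.klCoeff_mem_gaussianSpace ζ k i)]
  congr 1
  ext
  rw [Real.coe_toNNReal _ (hX.eigenvalue_nonneg hζ k i.1), NNReal.coe_pow, coe_nnnorm,
    norm_sq_eq_integral_sq, ← hX.integral_klCoeff_sq hζ]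
  refine integral_congr_ae ?_
  filter_upwards [hae] with ω hω
  rw [hω]

theorem integral_klCoeff (hX : IsCoefficientProcess P φ X) {a : ℕ → ℕ → ℝ}
    {ζ : ℕ → HilbertBasis ℕ ℝ (TimeL2 T)} (hζ : IsEigenSystem T φ a ζ) (k : ℕ) (i : Index) :
    ∫ ω, klCoeff T X ζ k i ω ∂P = 0 := by
  have h := integral_map (μ := P) (hX.measurable_klCoeff ζ k i).aemeasurable (f := id)
    aestronglyMeasurable_id
  rw [hX.map_klCoeff hζ] at h
  simpa using h.symm

/-- Distinct Karhunen–Loève coefficients are independent. -/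
theorem iIndepFun_klCoeff (hX : IsCoefficientProcess P φ X) {a : ℕ → ℕ → ℝ}
    {ζ : ℕ → HilbertBasis ℕ ℝ (TimeL2 T)} (hζ : IsEigenSystem T φ a ζ) {ι : Type*} [Fintype ι]
    {e : ι → Index × ℕ} (he : Function.Injective e) :
    iIndepFun (fun n => klCoeff T X ζ (e n).2 (e n).1) P := by
  refine HasGaussianLaw.iIndepFun_of_covariance_eq_zero
    (hasGaussianLaw_of_forall_mem hX.map_eq_gaussianReal_of_mem_gaussianSpace
      (fun n => hX.memLp_klCoeff ζ (e n).2 (e n).1)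
      fun n => hX.klCoeff_mem_gaussianSpace ζ (e n).2 (e n).1) fun m n hmn => ?_
  rw [covariance_eq_sub (hX.memLp_klCoeff ζ _ _) (hX.memLp_klCoeff ζ _ _),
    hX.integral_klCoeff hζ, zero_mul, sub_zero]
  simp only [Pi.mul_apply]
  rw [hX.integral_klCoeff_mul_klCoeff hζ, if_neg]
  exact fun h => hmn (he (Prod.ext h.1 h.2))

end IsCoefficientProcess

end SphereTime

namespace SphereTime

/-! ### Bounds for the eigenvalue tails -/

/-- The set of the `k` that are retained in degree `j` by the truncation at `(J, K)`. -/
def kept (J K j : ℕ) : Finset ℕ := if j ≤ J then Finset.range (K + 1) else ∅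

/-- All pairs `(j, m)` with `j < N`. -/
def indexBelow (N : ℕ) : Finset Index := (Finset.range N).sigma fun _ => Finset.univ

/-- The triples `(j, m, k)` with `j, k < N` that are removed by the truncation at `(J, K)`. -/
def removed (J K N : ℕ) : Finset (Index × ℕ) :=
  (indexBelow N ×ˢ Finset.range N).filter fun n => n.2 ∉ kept J K n.1.1

theorem sum_indexBelow (N : ℕ) (f : Index → ℝ) :
    ∑ i ∈ indexBelow N, f i = ∑ j ∈ Finset.range N, ∑ m : Fin (2 * j + 1), f ⟨j, m⟩ :=
  Finset.sum_sigma _ _ _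

theorem sum_removed (J K N : ℕ) (f : Index × ℕ → ℝ) :
    ∑ n ∈ removed J K N, f n =
      ∑ i ∈ indexBelow N, ∑ k ∈ Finset.range N, if k ∈ kept J K i.1 then 0 else f (i, k) := by
  rw [removed, Finset.sum_filter, Finset.sum_product]
  refine Finset.sum_congr rfl fun i _ => Finset.sum_congr rfl fun k _ => ?_
  by_cases h : k ∈ kept J K i.1 <;> simp [h]

theorem monotone_removed (J K : ℕ) : Monotone (removed J K) := by
  intro N M h n hn
  simp only [removed, indexBelow, Finset.mem_filter, Finset.mem_product, Finset.mem_sigma,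
    Finset.mem_range, Finset.mem_univ, and_true] at hn ⊢
  exact ⟨⟨hn.1.1.trans_le h, hn.1.2.trans_le h⟩, hn.2⟩

theorem c_sq (j : ℕ) : c j ^ 2 = 4 * Real.pi / (2 * j + 1) := Real.sq_sqrt (by positivity)

theorem two_mul_add_one_mul_c_sq (j : ℕ) : ((2 * j + 1 : ℕ) : ℝ) * c j ^ 2 = 4 * Real.pi := by
  rw [c_sq]
  push_cast
  field_simp

theorem sum_range_ite_kept_le {u : ℕ → ℕ → ℝ} (hu0 : ∀ j k, 0 ≤ u j k)
    (hu : Summable fun p : ℕ × ℕ => u p.1 p.2) (J K N : ℕ) :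
    ∑ j ∈ Finset.range N, ∑ k ∈ Finset.range N, (if k ∈ kept J K j then 0 else u j k) ≤
      (∑' j : ℕ, ∑' k : ℕ, u (J + 1 + j) k) +
        ∑ j ∈ Finset.range (J + 1), ∑' k : ℕ, u j (K + 1 + k) := by
  set w : ℕ → ℕ → ℝ := fun j k => if k ∈ kept J K j then 0 else u j k with hw
  have hw0 : ∀ j k, 0 ≤ w j k := fun j k => by
    simp only [hw]; split_ifs <;> simp [hu0]
  have hwu : ∀ j k, w j k ≤ u j k := fun j k => by
    simp only [hw]; split_ifs <;> simp [hu0]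
  have hws : Summable fun p : ℕ × ℕ => w p.1 p.2 :=
    hu.of_nonneg_of_le (fun p => hw0 _ _) fun p => hwu _ _
  have hrow : ∀ j, Summable (w j) := fun j => hws.prod_factor j
  have hcol : Summable fun j => ∑' k, w j k := hws.prod
  have h1 : ∀ j, J + 1 ≤ j → ∑' k, w j k = ∑' k, u j k := fun j hj => by
    refine tsum_congr fun k => ?_
    simp [hw, kept, show ¬ j ≤ J by omega]
  have h2 : ∀ j ∈ Finset.range (J + 1), ∑' k, w j k = ∑' k, u j (K + 1 + k) := fun j hj => by
    have hj' : j ≤ J := by simpa [Nat.lt_succ_iff] using hj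
    rw [← (hrow j).sum_add_tsum_nat_add (K + 1), Finset.sum_eq_zero, zero_add]
    · refine tsum_congr fun k => ?_
      simp [hw, kept, hj', add_comm k, show ¬ K + 1 + k ≤ K by omega]
    · intro k hk
      simp only [hw, kept, hj', if_true, if_pos hk]
  calc ∑ j ∈ Finset.range N, ∑ k ∈ Finset.range N, w j k
      ≤ ∑ j ∈ Finset.range N, ∑' k, w j k := Finset.sum_le_sum fun j _ =>
        (hrow j).sum_le_tsum _ fun k _ => hw0 j k
    _ ≤ ∑' j, ∑' k, w j k := hcol.sum_le_tsum _ fun j _ => tsum_nonneg (hw0 j)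
    _ = _ := by
      rw [← hcol.sum_add_tsum_nat_add (J + 1), add_comm, Finset.sum_congr rfl h2]
      congr 1
      refine tsum_congr fun j => ?_
      rw [h1 _ (by omega), add_comm j]

theorem sum_removed_eigenvalue_le {a : ℕ → ℕ → ℝ} (ha0 : ∀ k j, 0 ≤ a k j)
    (ha : Summable fun p : ℕ × ℕ => a p.2 p.1) (J K N : ℕ) :
    ∑ n ∈ removed J K N, c n.1.1 ^ 2 * a n.2 n.1.1 ≤ tailP a J K := by
  have h := sum_range_ite_kept_le (u := fun j k => a k j) (fun j k => ha0 k j) ha J K N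
  refine Eq.trans_le ?_ (mul_le_mul_of_nonneg_left h (by positivity : 0 ≤ 4 * Real.pi))
  rw [sum_removed, sum_indexBelow, Finset.mul_sum]
  refine Finset.sum_congr rfl fun j _ => ?_
  trans ∑ _m : Fin (2 * j + 1), c j ^ 2 *
    ∑ k ∈ Finset.range N, (if k ∈ kept J K j then 0 else a k j)
  · simp [Finset.mul_sum]
  · rw [Finset.sum_const, Finset.card_univ, Fintype.card_fin, nsmul_eq_mul,
      ← two_mul_add_one_mul_c_sq j, mul_assoc]

theorem summable_c_sq_mul_sq {a : ℕ → ℕ → ℝ} (ha0 : ∀ k j, 0 ≤ a k j)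
    (ha : Summable fun p : ℕ × ℕ => a p.2 p.1) :
    Summable fun p : ℕ × ℕ => c p.1 ^ 2 * a p.2 p.1 ^ 2 := by
  refine (ha.mul_left (4 * Real.pi * ∑' p : ℕ × ℕ, a p.2 p.1)).of_nonneg_of_le
    (fun p => by positivity) fun p => ?_
  have h1 : a p.2 p.1 ≤ ∑' p : ℕ × ℕ, a p.2 p.1 := ha.le_tsum p fun q _ => ha0 _ _
  have h2 : c p.1 ^ 2 ≤ 4 * Real.pi := by
    rw [c_sq]
    refine div_le_self (by positivity) ?_
    have : (0 : ℝ) ≤ p.1 := by positivity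
    linarith
  have h0 := ha0 p.2 p.1
  rw [sq (a p.2 p.1), ← mul_assoc]
  gcongr

theorem sum_removed_eigenvalue_sq_le {a : ℕ → ℕ → ℝ} (ha0 : ∀ k j, 0 ≤ a k j)
    (ha : Summable fun p : ℕ × ℕ => a p.2 p.1) (J K N : ℕ) :
    ∑ n ∈ removed J K N, (c n.1.1 ^ 2 * a n.2 n.1.1) ^ 2 ≤ tailQ a J K ^ 2 := by
  have h := sum_range_ite_kept_le (u := fun j k => c j ^ 2 * a k j ^ 2)
    (fun j k => by positivity) (summable_c_sq_mul_sq ha0 ha) J K N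
  simp_rw [tsum_mul_left] at h
  set W := (∑' j : ℕ, c (J + 1 + j) ^ 2 * ∑' k : ℕ, a k (J + 1 + j) ^ 2) +
    ∑ j ∈ Finset.range (J + 1), c j ^ 2 * ∑' k : ℕ, a (K + 1 + k) j ^ 2 with hW
  have hsum : ∑ n ∈ removed J K N, (c n.1.1 ^ 2 * a n.2 n.1.1) ^ 2 = 4 * Real.pi *
      ∑ j ∈ Finset.range N, ∑ k ∈ Finset.range N,
        (if k ∈ kept J K j then 0 else c j ^ 2 * a k j ^ 2) := by
    rw [sum_removed, sum_indexBelow, Finset.mul_sum]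
    refine Finset.sum_congr rfl fun j _ => ?_
    trans ∑ _m : Fin (2 * j + 1), c j ^ 2 *
      ∑ k ∈ Finset.range N, (if k ∈ kept J K j then 0 else c j ^ 2 * a k j ^ 2)
    · refine Finset.sum_congr rfl fun m _ => ?_
      rw [Finset.mul_sum]
      refine Finset.sum_congr rfl fun k _ => ?_
      split_ifs <;> ring
    · rw [Finset.sum_const, Finset.card_univ, Fintype.card_fin, nsmul_eq_mul,
        ← two_mul_add_one_mul_c_sq j, mul_assoc]
  have hW0 : 0 ≤ W := by positivity
  have hpi : 1 ≤ 4 * Real.pi := by linarith [Real.pi_gt_three]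
  rw [tailQ, ← hW, mul_pow, Real.sq_sqrt hW0, hsum]
  calc _ ≤ 4 * Real.pi * W := by gcongr
    _ ≤ (4 * Real.pi) ^ 2 * W := by
      gcongr
      nlinarith

/-! ### Orthogonal expansions on `S² × [0, T]` -/

variable {Y : Index → S2 → ℝ} {T : ℝ}

theorem l2norm_sq (f : S2 → ℝ → ℝ) :
    l2norm T f ^ 2 = ∫⁻ p, ‖f p.1 p.2‖ₑ ^ 2 ∂(surface.prod (timeMeasure T)) := by
  have h := eLpNorm_nnreal_pow_eq_lintegral (p := 2) (f := fun p : S2 × ℝ => f p.1 p.2)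
    (μ := surface.prod (timeMeasure T)) two_ne_zero
  simpa [l2norm] using h

theorem IsHarmonicBasis.memLp_mul (hY : IsHarmonicBasis Y) (i : Index) {R : ℝ → ℝ}
    (hR : MemLp R 2 (timeMeasure T)) :
    MemLp (fun p : S2 × ℝ => R p.2 * Y i p.1) 2 (surface.prod (timeMeasure T)) := by
  have hYm : MemLp (Y i) 2 surface := by
    obtain ⟨C, hC⟩ := isCompact_univ.exists_bound_of_continuousOn
      (hY.harmonic i).continuous.continuousOn
    exact MemLp.of_bound (hY.harmonic i).continuous.aestronglyMeasurable C
      (ae_of_all _ fun x => hC x (mem_univ x))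
  rw [memLp_two_iff_integrable_sq
    (hR.aestronglyMeasurable.comp_snd.fun_mul hYm.aestronglyMeasurable.comp_fst)]
  refine (hYm.integrable_sq.mul_prod hR.integrable_sq).congr (ae_of_all _ fun p => ?_)
  simp only
  ring

theorem IsHarmonicBasis.l2norm_sum_sq (hY : IsHarmonicBasis Y) (I : Finset Index)
    {R : Index → ℝ → ℝ} (hR : ∀ i ∈ I, MemLp (R i) 2 (timeMeasure T)) :
    l2norm T (fun x t => ∑ i ∈ I, R i t * Y i x) ^ 2 =
      ENNReal.ofReal (∑ i ∈ I, ∫ t, R i t ^ 2 ∂(timeMeasure T)) := by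
  set F : Index → S2 × ℝ → ℝ := fun i p => R i p.2 * Y i p.1
  have hF : ∀ i ∈ I, MemLp (F i) 2 (surface.prod (timeMeasure T)) := fun i hi =>
    hY.memLp_mul i (hR i hi)
  have hFF : ∀ i ∈ I, ∀ i' ∈ I,
      Integrable (fun p => F i p * F i' p) (surface.prod (timeMeasure T)) :=
    fun i hi i' hi' => (hF i hi).integrable_mul (hF i' hi')
  have hint : ∫ p, (∑ i ∈ I, F i p) ^ 2 ∂(surface.prod (timeMeasure T)) =
      ∑ i ∈ I, ∫ t, R i t ^ 2 ∂(timeMeasure T) := by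
    simp_rw [sq, Finset.sum_mul_sum]
    rw [integral_finsetSum _ fun i hi => integrable_finsetSum _ fun i' hi' => hFF i hi i' hi']
    refine Finset.sum_congr rfl fun i hi => ?_
    rw [integral_finsetSum _ fun i' hi' => hFF i hi i' hi']
    have hterm : ∀ i', ∫ p, F i p * F i' p ∂(surface.prod (timeMeasure T)) =
        (if i = i' then 1 else 0) * ∫ t, R i t * R i' t ∂(timeMeasure T) := fun i' => by
      rw [← hY.integral_mul i i', ← integral_prod_mul]
      refine integral_congr_ae (ae_of_all _ fun p => ?_)
      simp only [F]
      ring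
    simp_rw [hterm, ite_mul, one_mul, zero_mul, Finset.sum_ite_eq, if_pos hi]
  rw [l2norm_sq, ← hint, ofReal_integral_eq_lintegral_ofReal
    (memLp_finsetSum I hF).integrable_sq (ae_of_all _ fun _ => sq_nonneg _)]
  refine lintegral_congr fun p => ?_
  rw [← enorm_pow, Real.enorm_of_nonneg (sq_nonneg _)]

end SphereTime

namespace SphereTime

/-! ### Partial sums of the expansion of the field -/

variable {Ω : Type*} {φ : ℕ → ℝ → ℝ} {X : Index → ℝ → Ω → ℝ} {Y : Index → S2 → ℝ} {Z : S2 → ℝ → Ω → ℝ} {T : ℝ}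

/-- The sum of the terms of degree less than `N` in the expansion of the field. -/
noncomputable def partialField (Y : Index → S2 → ℝ) (X : Index → ℝ → Ω → ℝ) (N : ℕ) (x : S2) (t : ℝ) (ω : Ω) :
    ℝ :=
  ∑ j ∈ Finset.range N, c j * ∑ m : Fin (2 * j + 1), X ⟨j, m⟩ t ω * Y ⟨j, m⟩ x

/-- The part of `c_j X_{j,m}` that is removed by the truncation at `(J, K)`. -/
noncomputable def residual (T : ℝ) (X : Index → ℝ → Ω → ℝ) (ζ : ℕ → HilbertBasis ℕ ℝ (TimeL2 T)) (J K : ℕ)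
    (ω : Ω) (i : Index) (t : ℝ) : ℝ :=
  c i.1 * (X i t ω - ∑ k ∈ kept J K i.1, klCoeff T X ζ k i ω * (ζ i.1 k : TimeL2 T) t)

theorem partialField_sub_truncated (ζ : ℕ → HilbertBasis ℕ ℝ (TimeL2 T)) {J K N : ℕ}
    (hN : J + 1 ≤ N) (x : S2) (t : ℝ) (ω : Ω) :
    partialField Y X N x t ω - truncated T Y X ζ J K x t ω =
      ∑ i ∈ indexBelow N, residual T X ζ J K ω i t * Y i x := by
  have htr : truncated T Y X ζ J K x t ω = ∑ j ∈ Finset.range N, c j * ∑ m : Fin (2 * j + 1),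
      ∑ k ∈ kept J K j, klCoeff T X ζ k ⟨j, m⟩ ω * (ζ j k : TimeL2 T) t * Y ⟨j, m⟩ x := by
    rw [truncated, ← Finset.sum_subset (Finset.range_subset_range.2 hN)]
    · refine Finset.sum_congr rfl fun j hj => ?_
      rw [kept, if_pos (by simpa [Nat.lt_succ_iff] using hj)]
    · intro j _ hj
      rw [kept, if_neg (by simpa [Nat.lt_succ_iff] using hj)]
      simp
  rw [htr, partialField, ← Finset.sum_sub_distrib, sum_indexBelow]
  refine Finset.sum_congr rfl fun j _ => ?_
  rw [← mul_sub, ← Finset.sum_sub_distrib, Finset.mul_sum]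
  refine Finset.sum_congr rfl fun m _ => ?_
  simp only [residual]
  rw [← Finset.sum_mul]
  ring

variable [MeasurableSpace Ω] {P : Measure Ω}

theorem IsCoefficientProcess.integral_residual_sq_hasSum [IsProbabilityMeasure P]
    (hX : IsCoefficientProcess P φ X) (ζ : ℕ → HilbertBasis ℕ ℝ (TimeL2 T)) (J K : ℕ) :
    ∀ᵐ ω ∂P, ∀ i, MemLp (residual T X ζ J K ω i) 2 (timeMeasure T) ∧
      HasSum (fun k => if k ∈ kept J K i.1 then 0 else (c i.1 * klCoeff T X ζ k i ω) ^ 2)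
        (∫ t, residual T X ζ J K ω i t ^ 2 ∂(timeMeasure T)) := by
  filter_upwards [ae_all_iff.2 fun i => hX.memLp_path (T := T) i] with ω hω i
  constructor
  · refine ((hω i).sub (memLp_finsetSum (f := fun k t => klCoeff T X ζ k i ω *
      (ζ i.1 k : TimeL2 T) t) (kept J K i.1) fun k _ => (Lp.memLp (ζ i.1 k)).const_mul _)).const_mul
      (c i.1)
  · have h := (integral_sq_sub_basis_hasSum (ζ i.1) (hω i) (kept J K i.1)).mul_left (c i.1 ^ 2)
    simp only [residual, mul_pow]
    rw [integral_const_mul]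
    simpa only [klCoeff, mul_ite, mul_zero] using h

theorem l2norm_partialField_sub_truncated_le [IsProbabilityMeasure P]
    (hX : IsCoefficientProcess P φ X) (hY : IsHarmonicBasis Y)
    (ζ : ℕ → HilbertBasis ℕ ℝ (TimeL2 T)) (J K : ℕ) :
    ∀ᵐ ω ∂P, ∀ r : ℝ,
      (∀ N, ∑ n ∈ removed J K N, (c n.1.1 * klCoeff T X ζ n.2 n.1 ω) ^ 2 ≤ r) →
      ∀ N, J + 1 ≤ N →
        l2norm T (fun x t => partialField Y X N x t ω - truncated T Y X ζ J K x t ω) ^ 2 ≤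
          ENNReal.ofReal r := by
  filter_upwards [hX.integral_residual_sq_hasSum ζ J K] with ω hω r hr N hN
  simp_rw [partialField_sub_truncated ζ hN]
  rw [hY.l2norm_sum_sq _ fun i _ => (hω i).1]
  refine ENNReal.ofReal_le_ofReal ?_
  refine le_of_tendsto (tendsto_finsetSum _ fun i _ => (hω i).2.tendsto_sum_nat) ?_
  filter_upwards [eventually_ge_atTop N] with M hM
  refine le_trans ?_ (hr M)
  rw [sum_removed]
  refine Finset.sum_le_sum_of_subset_of_nonneg ?_ fun i _ _ => Finset.sum_nonneg fun k _ => ?_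
  · exact Finset.sigma_mono (Finset.range_subset_range.2 hM) fun _ => le_rfl
  · split_ifs <;> positivity

/-- The sum of the variances of the terms of degree `j` in the expansion of the field. -/
noncomputable def degreeVariance (φ : ℕ → ℝ → ℝ) (Y : Index → S2 → ℝ) (j : ℕ) (x : S2) : ℝ :=
  c j ^ 2 * φ j 0 * ∑ m : Fin (2 * j + 1), Y ⟨j, m⟩ x ^ 2

theorem IsCoefficientProcess.cov_zero_nonneg (hX : IsCoefficientProcess P φ X) (j : ℕ) :
    0 ≤ φ j 0 := by
  rw [← hX.integral_sq ⟨j, 0⟩ 0]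
  exact integral_nonneg fun _ => sq_nonneg _

theorem IsCoefficientProcess.degreeVariance_nonneg (hX : IsCoefficientProcess P φ X) (j : ℕ)
    (x : S2) : 0 ≤ degreeVariance φ Y j x := by
  have := hX.cov_zero_nonneg j
  unfold degreeVariance
  positivity

theorem eLpNorm_two_sq (f : Ω → ℝ) : eLpNorm f 2 P ^ 2 = ∫⁻ ω, ‖f ω‖ₑ ^ 2 ∂P := by
  simpa using eLpNorm_nnreal_pow_eq_lintegral (p := 2) (f := f) (μ := P) two_ne_zero

theorem IsCoefficientProcess.memLp_partialField (hX : IsCoefficientProcess P φ X) (N : ℕ) (x : S2)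
    (t : ℝ) : MemLp (partialField Y X N x t) 2 P := by
  unfold partialField
  exact memLp_finsetSum _ fun j _ => (memLp_finsetSum _ fun m _ =>
    (hX.memLp_eval ⟨j, m⟩ t).mul_const _).const_mul _

theorem IsCoefficientProcess.eLpNorm_partialField_sub_sq (hX : IsCoefficientProcess P φ X)
    {N M : ℕ} (hNM : N ≤ M) (x : S2) (t : ℝ) :
    eLpNorm (fun ω => partialField Y X M x t ω - partialField Y X N x t ω) 2 P ^ 2 =
      ENNReal.ofReal (∑ j ∈ Finset.Ico N M, degreeVariance φ Y j x) := by
  set I : Finset Index := (Finset.Ico N M).sigma fun _ => Finset.univ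
  have hdiff : ∀ ω, partialField Y X M x t ω - partialField Y X N x t ω =
      ∑ i ∈ I, c i.1 * Y i x * X i t ω := fun ω => by
    rw [partialField, partialField, ← Finset.sum_Ico_eq_sub _ hNM, Finset.sum_sigma]
    refine Finset.sum_congr rfl fun j _ => ?_
    rw [Finset.mul_sum]
    exact Finset.sum_congr rfl fun m _ => by ring
  have hmem : ∀ i ∈ I, MemLp (fun ω => c i.1 * Y i x * X i t ω) 2 P := fun i _ =>
    (hX.memLp_eval i t).const_mul _
  have hint : ∫ ω, (∑ i ∈ I, c i.1 * Y i x * X i t ω) ^ 2 ∂P =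
      ∑ j ∈ Finset.Ico N M, degreeVariance φ Y j x := by
    simp_rw [sq, Finset.sum_mul_sum]
    have hprod : ∀ i ∈ I, ∀ i' ∈ I, Integrable
        (fun ω => c i.1 * Y i x * X i t ω * (c i'.1 * Y i' x * X i' t ω)) P := fun i hi i' hi' =>
      (hmem i hi).integrable_mul (hmem i' hi')
    rw [integral_finsetSum _ fun i hi => integrable_finsetSum _ fun i' hi' => hprod i hi i' hi']
    have hterm : ∀ i i', ∫ ω, c i.1 * Y i x * X i t ω * (c i'.1 * Y i' x * X i' t ω) ∂P =
        if i = i' then c i.1 * Y i x * (c i'.1 * Y i' x) * φ i.1 0 else 0 := fun i i' => by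
      have h := hX.covariance i i' t t
      rw [sub_self] at h
      rw [← mul_ite_zero, ← h, ← integral_const_mul]
      exact integral_congr_ae (ae_of_all _ fun ω => by ring)
    have hrow : ∀ i ∈ I, ∫ ω, ∑ i' ∈ I, c i.1 * Y i x * X i t ω * (c i'.1 * Y i' x * X i' t ω) ∂P =
        c i.1 ^ 2 * φ i.1 0 * Y i x ^ 2 := fun i hi => by
      rw [integral_finsetSum _ fun i' hi' => hprod i hi i' hi']
      simp_rw [hterm, Finset.sum_ite_eq, if_pos hi]
      ring
    rw [Finset.sum_congr rfl hrow, Finset.sum_sigma]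
    simp_rw [degreeVariance, Finset.mul_sum]
  simp_rw [hdiff]
  rw [eLpNorm_two_sq, ← hint, ofReal_integral_eq_lintegral_ofReal
    (memLp_finsetSum I hmem).integrable_sq (ae_of_all _ fun _ => sq_nonneg _)]
  refine lintegral_congr fun p => ?_
  rw [← enorm_pow, Real.enorm_of_nonneg (sq_nonneg _)]

theorem IsExpandedField.measurable_section (hZ : IsExpandedField P Y X Z) (x : S2) (t : ℝ) :
    Measurable (Z x t) :=
  hZ.measurable.comp (measurable_prodMk_left (x := (x, t)))

theorem IsExpandedField.eLpNorm_sub_partialField_sq_le (hX : IsCoefficientProcess P φ X)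
    (hZ : IsExpandedField P Y X Z) (N : ℕ) (x : S2) (t : ℝ) :
    eLpNorm (fun ω => Z x t ω - partialField Y X N x t ω) 2 P ^ 2 ≤
      ∑' j, ENNReal.ofReal (degreeVariance φ Y (j + N) x) := by
  set B := ∑' j, ENNReal.ofReal (degreeVariance φ Y (j + N) x)
  have hmeas : ∀ M, AEStronglyMeasurable (partialField Y X M x t) P := fun M =>
    (hX.memLp_partialField M x t).aestronglyMeasurable
  have hB : ∀ M, N ≤ M →
      eLpNorm (fun ω => partialField Y X M x t ω - partialField Y X N x t ω) 2 P ≤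
        B ^ (2⁻¹ : ℝ) := fun M hM => by
    rw [ENNReal.le_rpow_inv_iff two_pos]
    rw [ENNReal.rpow_two, hX.eLpNorm_partialField_sub_sq hM, ENNReal.ofReal_sum_of_nonneg
      fun j _ => hX.degreeVariance_nonneg j x, Finset.sum_Ico_eq_sum_range]
    simp_rw [add_comm N]
    exact ENNReal.sum_le_tsum _
  have hle : eLpNorm (fun ω => Z x t ω - partialField Y X N x t ω) 2 P ≤ B ^ (2⁻¹ : ℝ) := by
    have hlim : Tendsto (fun M => eLpNorm (fun ω => Z x t ω - partialField Y X M x t ω) 2 P +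
        B ^ (2⁻¹ : ℝ)) atTop (𝓝 (0 + B ^ (2⁻¹ : ℝ))) :=
      (hZ.expansion x t).add tendsto_const_nhds
    rw [zero_add] at hlim
    refine ge_of_tendsto hlim ?_
    filter_upwards [eventually_ge_atTop N] with M hM
    refine le_trans ?_ (add_le_add le_rfl (hB M hM))
    refine le_trans (le_of_eq ?_) (eLpNorm_add_le
      ((hZ.measurable_section x t).aestronglyMeasurable.sub (hmeas M)) ((hmeas M).sub (hmeas N))
      one_le_two)
    congr 1
    ext ω
    simp
  calc _ ≤ (B ^ (2⁻¹ : ℝ)) ^ 2 := by gcongr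
    _ = B := by rw [← ENNReal.rpow_two, ← ENNReal.rpow_mul]; norm_num

theorem lintegral_degreeVariance (hX : IsCoefficientProcess P φ X) (hY : IsHarmonicBasis Y)
    (hT : 0 < T) (j : ℕ) :
    ∫⁻ p : S2 × ℝ, ENNReal.ofReal (degreeVariance φ Y j p.1) ∂(surface.prod (timeMeasure T)) =
      ENNReal.ofReal (4 * Real.pi * (T * φ j 0)) := by
  have hYi : ∀ m : Fin (2 * j + 1), Integrable (fun x => Y ⟨j, m⟩ x ^ 2) surface := fun m => by
    by_contra h
    have h1 := hY.integral_mul ⟨j, m⟩ ⟨j, m⟩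
    simp_rw [← sq] at h1
    rw [integral_undef h] at h1
    simp at h1
  have hint : Integrable (degreeVariance φ Y j) surface := by
    unfold degreeVariance
    exact (integrable_finsetSum _ fun m _ => hYi m).const_mul _
  rw [← ofReal_integral_eq_lintegral_ofReal (hint.comp_fst _)
    (ae_of_all _ fun p => hX.degreeVariance_nonneg j p.1)]
  congr 1
  rw [integral_fun_fst (degreeVariance φ Y j), timeMeasure_real_univ hT, smul_eq_mul]
  unfold degreeVariance
  rw [integral_const_mul, integral_finsetSum _ fun m _ => hYi m]
  have h1 : ∀ m : Fin (2 * j + 1), ∫ x, Y ⟨j, m⟩ x ^ 2 ∂surface = 1 := fun m => by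
    simp_rw [sq, hY.integral_mul, if_true]
  simp_rw [h1, Finset.sum_const, Finset.card_univ, Fintype.card_fin, nsmul_eq_mul, mul_one]
  rw [← two_mul_add_one_mul_c_sq j]
  ring

theorem measurable_field_sub_partialField (hX : IsCoefficientProcess P φ X) (hY : IsHarmonicBasis Y)
    (hZ : IsExpandedField P Y X Z) (N : ℕ) :
    Measurable fun q : Ω × (S2 × ℝ) => Z q.2.1 q.2.2 q.1 - partialField Y X N q.2.1 q.2.2 q.1 := by
  have hXm : ∀ i, Measurable fun q : Ω × (S2 × ℝ) => X i q.2.2 q.1 := fun i =>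
    (hX.measurable i).comp (measurable_snd.snd.prodMk measurable_fst)
  have hYm : ∀ i, Measurable fun q : Ω × (S2 × ℝ) => Y i q.2.1 := fun i =>
    (hY.harmonic i).continuous.measurable.comp measurable_snd.fst
  refine (hZ.measurable.comp (measurable_snd.prodMk measurable_fst)).sub ?_
  unfold partialField
  exact Finset.measurable_fun_sum _ fun j _ => (Finset.measurable_fun_sum _ fun m _ =>
    (hXm _).mul (hYm _)).const_mul _

theorem lintegral_l2norm_sub_partialField_sq_le [IsProbabilityMeasure P]
    (hX : IsCoefficientProcess P φ X)
    (hY : IsHarmonicBasis Y) (hZ : IsExpandedField P Y X Z) (hT : 0 < T) (N : ℕ) :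
    ∫⁻ ω, l2norm T (fun x t => Z x t ω - partialField Y X N x t ω) ^ 2 ∂P ≤
      ∑' j, ENNReal.ofReal (4 * Real.pi * (T * φ (j + N) 0)) := by
  have hm := measurable_field_sub_partialField hX hY hZ N
  simp_rw [l2norm_sq]
  rw [lintegral_lintegral_swap (hm.enorm.pow_const 2).aemeasurable]
  calc _ ≤ ∫⁻ p : S2 × ℝ, ∑' j, ENNReal.ofReal (degreeVariance φ Y (j + N) p.1)
        ∂(surface.prod (timeMeasure T)) := lintegral_mono fun p => by
          rw [← eLpNorm_two_sq fun ω => Z p.1 p.2 ω - partialField Y X N p.1 p.2 ω]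
          exact hZ.eLpNorm_sub_partialField_sq_le hX N p.1 p.2
    _ = _ := by
      rw [lintegral_tsum fun j => ?_]
      · simp_rw [lintegral_degreeVariance hX hY hT]
      · refine (ENNReal.measurable_ofReal.comp ?_).aemeasurable
        unfold degreeVariance
        exact (Finset.measurable_fun_sum _ fun m _ =>
          ((hY.harmonic _).continuous.measurable.comp measurable_fst).pow_const 2).const_mul _

theorem liminf_l2norm_sub_partialField_sq [IsProbabilityMeasure P]
    (hX : IsCoefficientProcess P φ X)
    (hY : IsHarmonicBasis Y) (hZ : IsExpandedField P Y X Z) (hT : 0 < T)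
    (hφ : Summable fun j => T * φ j 0) :
    ∀ᵐ ω ∂P, liminf
      (fun N => l2norm T (fun x t => Z x t ω - partialField Y X N x t ω) ^ 2) atTop = 0 := by
  have hmeas : ∀ N,
      Measurable fun ω => l2norm T (fun x t => Z x t ω - partialField Y X N x t ω) ^ 2 := fun N => by
    simp_rw [l2norm_sq]
    exact ((measurable_field_sub_partialField hX hY hZ N).enorm.pow_const 2).lintegral_prod_right'
  have hlim : Tendsto
      (fun N => ∫⁻ ω, l2norm T (fun x t => Z x t ω - partialField Y X N x t ω) ^ 2 ∂P) atTop (𝓝 0) :=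
    tendsto_of_tendsto_of_tendsto_of_le_of_le tendsto_const_nhds
      (ENNReal.tendsto_sum_nat_add (fun j => ENNReal.ofReal (4 * Real.pi * (T * φ j 0)))
        (hφ.mul_left (4 * Real.pi)).tsum_ofReal_ne_top)
      (fun _ => bot_le) (lintegral_l2norm_sub_partialField_sq_le hX hY hZ hT)
  have h := lintegral_liminf_le (μ := P) (u := atTop) hmeas
  rw [hlim.liminf_eq, nonpos_iff_eq_zero, lintegral_eq_zero_iff (Measurable.liminf hmeas)] at h
  exact h

/-- Almost surely, the truncation error is at most the limit of the sums of squares of the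
removed Karhunen–Loève coefficients. -/
theorem exists_lt_sum_removed_of_lt_l2norm [IsProbabilityMeasure P]
    (hX : IsCoefficientProcess P φ X)
    (hY : IsHarmonicBasis Y) (hZ : IsExpandedField P Y X Z) (hT : 0 < T)
    (hφ : Summable fun j => T * φ j 0) (ζ : ℕ → HilbertBasis ℕ ℝ (TimeL2 T)) (J K : ℕ) :
    ∀ᵐ ω ∂P, ∀ r : ℝ,
      ENNReal.ofReal (Real.sqrt r) <
        l2norm T (fun x t => Z x t ω - truncated T Y X ζ J K x t ω) →
      ∃ N, r < ∑ n ∈ removed J K N, (c n.1.1 * klCoeff T X ζ n.2 n.1 ω) ^ 2 := by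
  filter_upwards [l2norm_partialField_sub_truncated_le hX hY ζ J K,
    liminf_l2norm_sub_partialField_sq hX hY hZ hT hφ,
    hX.integral_residual_sq_hasSum ζ J K] with ω h1 h2 h3 r hr
  by_contra! hN
  refine hr.not_ge (ENNReal.le_of_forall_pos_le_add fun δ hδ _ => ?_)
  have hδ' : (0 : ENNReal) < (δ : ENNReal) ^ 2 := by positivity
  have hfreq := (frequently_lt_of_liminf_lt (by isBoundedDefault)
    (h2.trans_lt hδ')).and_eventually (eventually_ge_atTop (J + 1))
  obtain ⟨N, hNδ, hNJ⟩ := hfreq.exists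
  have hfirst : l2norm T (fun x t => Z x t ω - partialField Y X N x t ω) ≤ δ :=
    (ENNReal.pow_le_pow_left_iff two_ne_zero).1 hNδ.le
  have hsecond : l2norm T (fun x t => partialField Y X N x t ω - truncated T Y X ζ J K x t ω) ≤
      ENNReal.ofReal (Real.sqrt r) := by
    have hr0 : 0 ≤ r := le_trans (Finset.sum_nonneg fun n _ => sq_nonneg _) (hN 0)
    have h := h1 r hN N hNJ
    rw [← Real.sq_sqrt hr0, ENNReal.ofReal_pow (Real.sqrt_nonneg r)] at h
    exact (ENNReal.pow_le_pow_left_iff two_ne_zero).1 h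
  have hm1 : AEStronglyMeasurable
      (fun p : S2 × ℝ => Z p.1 p.2 ω - partialField Y X N p.1 p.2 ω)
      (surface.prod (timeMeasure T)) :=
    ((measurable_field_sub_partialField hX hY hZ N).comp measurable_prodMk_left).aestronglyMeasurable
  have hm2 : AEStronglyMeasurable
      (fun p : S2 × ℝ => partialField Y X N p.1 p.2 ω - truncated T Y X ζ J K p.1 p.2 ω)
      (surface.prod (timeMeasure T)) := by
    simp_rw [partialField_sub_truncated ζ hNJ]
    exact (memLp_finsetSum _ fun i _ => hY.memLp_mul i (h3 i).1).aestronglyMeasurable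
  calc l2norm T (fun x t => Z x t ω - truncated T Y X ζ J K x t ω)
      ≤ l2norm T (fun x t => Z x t ω - partialField Y X N x t ω) +
        l2norm T (fun x t => partialField Y X N x t ω - truncated T Y X ζ J K x t ω) := by
        refine le_trans (le_of_eq ?_) (eLpNorm_add_le hm1 hm2 one_le_two)
        unfold l2norm
        congr 1
        ext p
        simp
    _ ≤ δ + ENNReal.ofReal (Real.sqrt r) := add_le_add hfirst hsecond
    _ = _ := add_comm _ _

end SphereTime

open SphereTime in
theorem mainTheorem5 {Ω : Type*} [MeasurableSpace Ω] (P : MeasureTheory.Measure Ω)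
    [MeasureTheory.IsProbabilityMeasure P] (T : ℝ) (hT : 0 < T)
    (Y : SphereTime.Index → SphereTime.S2 → ℝ) (hY : SphereTime.IsHarmonicBasis Y)
    (φ : ℕ → ℝ → ℝ) (X : SphereTime.Index → ℝ → Ω → ℝ)
    (hX : SphereTime.IsCoefficientProcess P φ X)
    (Z : SphereTime.S2 → ℝ → Ω → ℝ) (hZ : SphereTime.IsExpandedField P Y X Z)
    (a : ℕ → ℕ → ℝ) (ζ : ℕ → HilbertBasis ℕ ℝ (SphereTime.TimeL2 T))
    (hζ : SphereTime.IsEigenSystem T φ a ζ)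
    (ha : Summable fun p : ℕ × ℕ => a p.2 p.1)
    (J K : ℕ) (ε : ℝ) (hε : 0 < ε) :
    P {ω | ENNReal.ofReal
          (Real.sqrt (SphereTime.tailP a J K + ε * SphereTime.tailQ a J K)) <
        SphereTime.l2norm T (fun x t => Z x t ω - SphereTime.truncated T Y X ζ J K x t ω)} ≤
      ENNReal.ofReal (Real.exp (-ε / 2) * Real.sqrt (ε + 1)) := by
  have ha0 : ∀ k j, 0 ≤ a k j := hX.eigenvalue_nonneg hζ
  have hφ : Summable fun j => T * φ j 0 := by
    have h := ha.prod
    refine h.congr fun j => ?_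
    exact (hX.hasSum_eigenvalue hT hζ (ha.prod_factor j)).tsum_eq
  set A : ℕ → Set Ω := fun N => {ω | tailP a J K + ε * tailQ a J K <
    ∑ n ∈ removed J K N, (c n.1.1 * klCoeff T X ζ n.2 n.1 ω) ^ 2}
  have hAmono : Monotone A := fun N M hNM =>
    Set.ofPred_subset_ofPred.2 fun ω hω => hω.trans_le (Finset.sum_le_sum_of_subset_of_nonneg (monotone_removed J K hNM)
      fun _ _ _ => sq_nonneg _)
  have hA : ∀ N, P (A N) ≤ ENNReal.ofReal (Real.exp (-ε / 2) * Real.sqrt (ε + 1)) := fun N => by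
    have hind := (hX.iIndepFun_klCoeff hζ (e := fun n : removed J K N => n.1)
      Subtype.val_injective).comp (fun n x => c n.1.1.1 * x) fun n => measurable_const_mul _
    have hlaw : ∀ n : removed J K N,
        P.map (fun ω => c n.1.1.1 * klCoeff T X ζ n.1.2 n.1.1 ω) =
          gaussianReal 0 (c n.1.1.1 ^ 2 * a n.1.2 n.1.1.1).toNNReal := fun n => by
      have h := gaussianReal_map_const_mul (μ := 0) (v := (a n.1.2 n.1.1.1).toNNReal) (c n.1.1.1)
      rw [← hX.map_klCoeff hζ, Measure.map_map (measurable_const_mul _)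
        (hX.measurable_klCoeff ζ _ _), mul_zero] at h
      refine h.trans ?_
      congr 1
      ext
      simp [ha0, mul_nonneg, sq_nonneg]
    have hv : ∀ n : Index × ℕ, ((c n.1.1 ^ 2 * a n.2 n.1.1).toNNReal : ℝ) =
        c n.1.1 ^ 2 * a n.2 n.1.1 := fun n =>
      Real.coe_toNNReal _ (mul_nonneg (sq_nonneg _) (ha0 _ _))
    have h := measure_sum_sq_gt_le (P := P) (A := tailP a J K) (B := tailQ a J K)
      (v := fun n : removed J K N => (c n.1.1.1 ^ 2 * a n.1.2 n.1.1.1).toNNReal)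
      (fun n : removed J K N => (hX.measurable_klCoeff ζ n.1.2 n.1.1).const_mul _) hind hlaw
      (by
        simp_rw [hv]
        rw [Finset.sum_coe_sort (removed J K N) fun n => c n.1.1 ^ 2 * a n.2 n.1.1]
        exact sum_removed_eigenvalue_le ha0 ha J K N)
      (by unfold tailQ; positivity)
      (by
        simp_rw [hv]
        rw [Finset.sum_coe_sort (removed J K N) fun n => (c n.1.1 ^ 2 * a n.2 n.1.1) ^ 2]
        exact sum_removed_eigenvalue_sq_le ha0 ha J K N) hε
    refine le_trans (measure_mono fun ω hω => ?_) h
    rw [Set.mem_ofPred_eq, Finset.sum_coe_sort (removed J K N) fun n =>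
      (c n.1.1 * klCoeff T X ζ n.2 n.1 ω) ^ 2]
    exact hω
  calc _ ≤ P (⋃ N, A N) := by
        refine measure_mono_ae ?_
        filter_upwards [exists_lt_sum_removed_of_lt_l2norm hX hY hZ hT hφ ζ J K] with ω hω h
        exact Set.mem_iUnion.2 (hω _ h)
    _ = ⨆ N, P (A N) := hAmono.measure_iUnion
    _ ≤ _ := iSup_le hA
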